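/- Let $d\ge 1$, let $x_0\in\mathbb R^d$ have support $T=\{j : x_0(j)\neq 0\}$, and let $\mathcal S=(S_i)_{i=1}^k$ be a partition of $\{1,\dots,d\}$ into pairwise disjoint nonempty sets. Put $$\sigma=\frac{|T|}{d},\qquad \rho_i=\frac{|S_i|}{d},\qquad \alpha_i=\frac{|T\cap S_i|}{|S_i|},\qquad \bar\alpha=\min_i\alpha_i ,$$ and assume $\alpha_i>0$ for every $i$. Let $\omega_1,\dots,\omega_k\ge 0$, let $w=\sum_{i=1}^k\omega_i 1_{S_i}\in\mathbb R^d$, and let $\|x\|_{1,w}=\sum_{j=1}^d w_j|x(j)|$. For $t\ge 0$ let $$\varphi(t)=\sqrt{\tfrac{2}{\pi}}\int_t^\infty (x-t)^2e^{-x^2/2}\,dx,$$ and define $$\tilde m_{\mathcal S,T,w}=\inf_{\tau>0}\Big(\sigma+\sum_{i=1}^k\rho_i\big(\alpha_i(\omega_i\tau)^2+(1-\alpha_i)\varphi(\omega_i\tau)\big)\Big).$$ Let $\mathcal D=\{v\in\mathbb R^d : \exists\,\tau>0,\ \|x_0+\tau v\|_{1,w}\le\|x_0\|_{1,w}\}$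 be the descent cone of $\|\cdot\|_{1,w}$ at $x_0$, and let $\delta(\mathcal D)=\mathbb E\,\|\Pi_{\overline{\mathcal D}}\,g\|_2^2$ be its statistical dimension, where $g$ is a standard Gaussian vector in $\mathbb R^d$ and $\Pi_{\overline{\mathcal D}}$ is the metric (Euclidean nearest-point) projection onto the closure of $\mathcal D$. Then $$\tilde m_{\mathcal S,T,w}-\frac{2}{d}\sqrt{\frac1{\bar\alpha}}\ \le\ \frac{\delta(\mathcal D)}{d}\ \le\ \tilde m_{\mathcal S,T,w}.$$ Moreover, the following bound, independent of $\alpha$, holds: $$\tilde m_{\mathcal S,T,w}-\frac{2}{\sqrt d}\ \le\ \frac{\delta(\mathcal D)}{d}\ \le\ \tilde m_{\mathcal S,T,w}.$$ -/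

import Mathlib

open MeasureTheory ProbabilityTheory

noncomputable section

/-! ### Cones and statistical dimension -/

/-- The descent cone of `f` at `x₀`: all directions in which some positive step does not
increase `f`. -/
def descentCone {d : ℕ} (f : EuclideanSpace ℝ (Fin d) → ℝ) (x₀ : EuclideanSpace ℝ (Fin d)) :
    Set (EuclideanSpace ℝ (Fin d)) :=
  {v | ∃ τ : ℝ, 0 < τ ∧ f (x₀ + τ • v) ≤ f x₀}

/-- The metric projection `argmin_{c ∈ K} ‖c - x‖₂` of `x` onto `K`. The minimizer exists and is
unique when `K` is nonempty, closed and convex, see `metricProj_spec` and `metricProj_unique`. -/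
def metricProj {d : ℕ} (K : Set (EuclideanSpace ℝ (Fin d))) (x : EuclideanSpace ℝ (Fin d)) :
    EuclideanSpace ℝ (Fin d) :=
  Classical.epsilon fun c => c ∈ K ∧ ∀ c' ∈ K, ‖c - x‖ ≤ ‖c' - x‖

theorem metricProj_spec {d : ℕ} {K : Set (EuclideanSpace ℝ (Fin d))} (hne : K.Nonempty)
    (hcl : IsClosed K) (x : EuclideanSpace ℝ (Fin d)) :
    metricProj K x ∈ K ∧ ∀ c ∈ K, ‖metricProj K x - x‖ ≤ ‖c - x‖ := by
  refine Classical.epsilon_spec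
    (p := fun c => c ∈ K ∧ ∀ c' ∈ K, ‖c - x‖ ≤ ‖c' - x‖) ?_
  obtain ⟨y, hy, hxy⟩ := hcl.exists_infDist_eq_dist hne x
  refine ⟨y, hy, fun c hc => ?_⟩
  rw [← dist_eq_norm, ← dist_eq_norm, dist_comm y, dist_comm c, ← hxy]
  exact Metric.infDist_le_dist_of_mem hc

theorem metricProj_unique {d : ℕ} {K : Set (EuclideanSpace ℝ (Fin d))} (hcl : IsClosed K)
    (hconv : Convex ℝ K) {x c : EuclideanSpace ℝ (Fin d)} (hc : c ∈ K)
    (hmin : ∀ c' ∈ K, ‖c - x‖ ≤ ‖c' - x‖) : metricProj K x = c := by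
  obtain ⟨hp, hpmin⟩ := metricProj_spec ⟨c, hc⟩ hcl x
  set p := metricProj K x
  have heq : ‖p - x‖ = ‖c - x‖ := le_antisymm (hpmin c hc) (hmin p hp)
  have hmid : (1 / 2 : ℝ) • p + (1 / 2 : ℝ) • c ∈ K :=
    hconv hp hc (by norm_num) (by norm_num) (by norm_num)
  have h1 := hmin _ hmid
  have h2 : (1 / 2 : ℝ) • p + (1 / 2 : ℝ) • c - x = (1 / 2 : ℝ) • ((p - x) + (c - x)) := by
    module
  have h3 := parallelogram_law_with_norm ℝ (p - x) (c - x)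
  have h4 : ‖(1 / 2 : ℝ) • ((p - x) + (c - x))‖ = (1 / 2) * ‖(p - x) + (c - x)‖ := by
    rw [norm_smul]; norm_num
  rw [h2, h4] at h1
  have h5 : (p - x) - (c - x) = p - c := by abel
  rw [h5, heq] at h3
  have h6 : ‖p - c‖ = 0 := by
    nlinarith [norm_nonneg (p - c), norm_nonneg (c - x), norm_nonneg ((p - x) + (c - x))]
  exact sub_eq_zero.mp (norm_eq_zero.mp h6)

/-- The statistical dimension `δ(C) = E ‖Π_{closure C} g‖₂²` of a convex cone `C ⊆ ℝᵈ`, where `g`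
is a standard Gaussian vector. -/
def statDim {d : ℕ} (C : Set (EuclideanSpace ℝ (Fin d))) : ℝ :=
  ∫ g, ‖metricProj (closure C) g‖ ^ 2 ∂(stdGaussian (EuclideanSpace ℝ (Fin d)))

/-! ### The weighted `ℓ¹`-norm and the parameters of a partition -/

/-- The weighted `ℓ¹`-norm `∑ⱼ wⱼ |xⱼ|`. -/
def weightedL1 {d : ℕ} (w : Fin d → ℝ) (x : EuclideanSpace ℝ (Fin d)) : ℝ :=
  ∑ j, w j * |x j|

/-- The weight vector `w = ∑ᵢ ωᵢ 1_{Sᵢ}`. -/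
def blockWeight {d k : ℕ} (S : Fin k → Finset (Fin d)) (ω : Fin k → ℝ) : Fin d → ℝ :=
  fun j => ∑ i, if j ∈ S i then ω i else 0

/-- The support of a vector. -/
def vecSupport {d : ℕ} (x : EuclideanSpace ℝ (Fin d)) : Finset (Fin d) :=
  Finset.univ.filter fun j => x j ≠ 0

/-- `ρᵢ = |Sᵢ| / d`. -/
def relSize {d k : ℕ} (S : Fin k → Finset (Fin d)) (i : Fin k) : ℝ :=
  ((S i).card : ℝ) / d

/-- `αᵢ = |T ∩ Sᵢ| / |Sᵢ|`. -/
def relDensity {d k : ℕ} (S : Fin k → Finset (Fin d)) (T : Finset (Fin d)) (i : Fin k) : ℝ :=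
  ((T ∩ S i).card : ℝ) / ((S i).card : ℝ)

/-- `φ(t) = √(2/π) ∫_t^∞ (x - t)² exp(-x²/2) dx`. -/
def gaussTail (t : ℝ) : ℝ :=
  Real.sqrt (2 / Real.pi) * ∫ x in Set.Ioi t, (x - t) ^ 2 * Real.exp (-x ^ 2 / 2)

/-- `J_{σ,α,ρ,ω}(τ) = σ + ∑ᵢ ρᵢ (αᵢ (ωᵢ τ)² + (1 - αᵢ) φ(ωᵢ τ))`. -/
def Jfun {k : ℕ} (σ : ℝ) (α ρ ω : Fin k → ℝ) (τ : ℝ) : ℝ :=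
  σ + ∑ i, ρ i * (α i * (ω i * τ) ^ 2 + (1 - α i) * gaussTail (ω i * τ))

/-- `m̃_{S,T,w} = inf_{τ > 0} J_{σ,α,ρ,ω}(τ)` for the parameters `σ = |T| / d`, `α`, `ρ` that
belong to the partition `S` and the support `T`, where `w = ∑ᵢ ωᵢ 1_{Sᵢ}`. -/
def mTilde {d k : ℕ} (S : Fin k → Finset (Fin d)) (T : Finset (Fin d)) (ω : Fin k → ℝ) : ℝ :=
  ⨅ τ : Set.Ioi (0 : ℝ), Jfun ((T.card : ℝ) / d) (relDensity S T) (relSize S) ω τ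

/-- `ᾱ = minᵢ αᵢ` (the infimum of a finite family). -/
def minDensity {d k : ℕ} (S : Fin k → Finset (Fin d)) (T : Finset (Fin d)) : ℝ :=
  ⨅ i, relDensity S T i

end

/-! ### Gaussian Poincaré inequality with constant π²/8. -/

section GaussianPoincare

/-! Write F(t, g) for the squared distance from g to t times the subdifferential of the weighted
norm at x₀ (`scaledSqDist`). The polar of the descent cone is generated by that subdifferential, so
by Moreau's decomposition the squared norm of the projection of g is the minimum of F(t, g) over t ≥
0, attained at some τ(g). Thus δ is E min F, while d m̃ is inf E F (`Jfun_eq_integral_div`), and the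
upper bound is immediate.

For the lower bound, let A be the sum of w_j² over the support, V the sum over all j, and s(t, g)
minus half the t-derivative of F. Strong convexity in t (`scaledSqDist_ge`) gives F(t, g) ≤ F(τ, g)
+ 2s(τ - t) - A(τ - t)². Choose t with E s = 0; then E[s(τ - t)] is the covariance of s and τ. Since
τ is Lipschitz with constant 1/√A (`abs_sub_scale_le`), the Poincaré inequality bounds Var τ by
5/(4A). Coordinatewise independence bounds Var s by (3A + 2V)/5. Together these bound the error by
2√(V/A) (`integral_cross_term_le`). Comparing A and V block by block gives V/A ≤ 1/ᾱ ≤ d, hence both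
lower bounds. If A = 0, all weights vanish and there is no error. -/

/-- The variance is half the mean squared difference of two independent copies. -/
theorem two_mul_variance_eq_integral_prod {Ω : Type*} [MeasurableSpace Ω] {μ : Measure Ω}
    [IsProbabilityMeasure μ] {X : Ω → ℝ} (hX : MemLp X 2 μ) :
    2 * Var[X; μ] = ∫ z, (X z.1 - X z.2) ^ 2 ∂(μ.prod μ) := by
  have hi : Integrable X μ := hX.integrable (by norm_num)
  have hsq : Integrable (fun x => X x ^ 2) μ := hX.integrable_sq
  have h1 : Integrable (fun z : Ω × Ω => X z.1 ^ 2) (μ.prod μ) := hsq.comp_fst μ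
  have h2 : Integrable (fun z : Ω × Ω => X z.2 ^ 2) (μ.prod μ) := hsq.comp_snd μ
  have h3 : Integrable (fun z : Ω × Ω => X z.1 * X z.2) (μ.prod μ) := hi.mul_prod hi
  have e : (fun z : Ω × Ω => (X z.1 - X z.2) ^ 2)
      = fun z => (X z.1 ^ 2 + X z.2 ^ 2) - 2 * (X z.1 * X z.2) := by
    ext z; ring
  have h12 : Integrable (fun z : Ω × Ω => X z.1 ^ 2 + X z.2 ^ 2) (μ.prod μ) := h1.add h2
  rw [e, integral_sub h12 (h3.const_mul 2), integral_add h1 h2, integral_const_mul,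
    integral_prod_mul, integral_fun_fst (f := fun x => X x ^ 2),
    integral_fun_snd (f := fun x => X x ^ 2), variance_eq_sub hX]
  simp only [probReal_univ, one_smul, Pi.pow_apply]
  ring

/-- Cauchy-Schwarz for the mean of a continuous function over an interval. -/
theorem sq_intervalIntegral_le {f : ℝ → ℝ} (hf : Continuous f) {b : ℝ} (hb : 0 < b) :
    (∫ x in (0 : ℝ)..b, f x) ^ 2 ≤ b * ∫ x in (0 : ℝ)..b, f x ^ 2 := by
  set I := ∫ x in (0 : ℝ)..b, f x with hI
  -- Expanding the square, this integral equals b (b ∫ f² - I²).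
  have h0 : 0 ≤ ∫ x in (0 : ℝ)..b, (b * f x - I) ^ 2 :=
    intervalIntegral.integral_nonneg hb.le fun x _ => sq_nonneg _
  have e : (fun x => (b * f x - I) ^ 2)
      = fun x => (b ^ 2 * f x ^ 2 - (2 * b * I) * f x) + I ^ 2 := by
    ext x; ring
  have i1 : IntervalIntegrable (fun x => b ^ 2 * f x ^ 2) volume 0 b :=
    (by fun_prop : Continuous fun x => b ^ 2 * f x ^ 2).intervalIntegrable _ _
  have i2 : IntervalIntegrable (fun x => (2 * b * I) * f x) volume 0 b :=
    (by fun_prop : Continuous fun x => (2 * b * I) * f x).intervalIntegrable _ _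
  rw [e, intervalIntegral.integral_add (i1.sub i2) (by simp), intervalIntegral.integral_sub i1 i2,
    intervalIntegral.integral_const_mul, intervalIntegral.integral_const_mul,
    intervalIntegral.integral_const, ← hI] at h0
  simp only [sub_zero, smul_eq_mul] at h0
  have h1 : 0 ≤ b * (b * (∫ x in (0 : ℝ)..b, f x ^ 2) - I ^ 2) := by nlinarith
  linarith [nonneg_of_mul_nonneg_right h1 hb]


variable {E : Type*} [NormedAddCommGroup E] [InnerProductSpace ℝ E]

/-- Fundamental theorem of calculus along a quarter rotation, squared. -/
theorem sq_sub_le_integral_rotation {h : E → ℝ} (hc : ContDiff ℝ 1 h) (z : E × E) :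
    (h z.1 - h z.2) ^ 2 ≤ (Real.pi / 2) * ∫ θ in (0 : ℝ)..(Real.pi / 2),
      (fderiv ℝ h (ContinuousLinearMap.rotation θ z).1 (ContinuousLinearMap.rotation θ z).2) ^ 2 := by
  have hfc : Continuous (fderiv ℝ h) := hc.continuous_fderiv (by norm_num)
  have hγ : ∀ θ : ℝ, HasDerivAt (fun θ : ℝ => Real.cos θ • z.1 + Real.sin θ • z.2)
      (-Real.sin θ • z.1 + Real.cos θ • z.2) θ := fun θ =>
    ((Real.hasDerivAt_cos θ).smul_const z.1).add ((Real.hasDerivAt_sin θ).smul_const z.2)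
  have hcont : Continuous fun θ : ℝ => fderiv ℝ h (Real.cos θ • z.1 + Real.sin θ • z.2)
      (-Real.sin θ • z.1 + Real.cos θ • z.2) :=
    (hfc.comp (by fun_prop)).clm_apply (by fun_prop)
  have hd : ∀ θ : ℝ, HasDerivAt (fun θ : ℝ => h (Real.cos θ • z.1 + Real.sin θ • z.2))
      (fderiv ℝ h (Real.cos θ • z.1 + Real.sin θ • z.2)
        (-Real.sin θ • z.1 + Real.cos θ • z.2)) θ := fun θ =>
    ((hc.differentiable (by norm_num)) _).hasFDerivAt.comp_hasDerivAt θ (hγ θ)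
  have hftc := intervalIntegral.integral_eq_sub_of_hasDerivAt
    (a := 0) (b := Real.pi / 2) (fun θ _ => hd θ) (hcont.intervalIntegrable _ _)
  simp only [Real.cos_pi_div_two, Real.sin_pi_div_two, Real.cos_zero, Real.sin_zero, zero_smul,
    one_smul, zero_add, add_zero] at hftc
  have := sq_intervalIntegral_le hcont (b := Real.pi / 2) (by positivity)
  rw [hftc] at this
  simp only [ContinuousLinearMap.rotation_apply]
  calc (h z.1 - h z.2) ^ 2 = (h z.2 - h z.1) ^ 2 := by ring
    _ ≤ _ := this

variable [FiniteDimensional ℝ E] [MeasurableSpace E] [BorelSpace E]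

theorem memLp_two_norm_stdGaussian : MemLp (fun x : E => ‖x‖) 2 (stdGaussian E) :=
  (IsGaussian.memLp_two_id (μ := stdGaussian E)).norm

theorem lipschitz_memLp_two {h : E → ℝ} {L : NNReal} (hL : LipschitzWith L h) :
    MemLp h 2 (stdGaussian E) := by
  have h1 : MemLp (fun x : E => |h 0| + L * ‖x‖) 2 (stdGaussian E) :=
    (memLp_const |h 0|).add (memLp_two_norm_stdGaussian.const_mul (L : ℝ))
  refine MemLp.mono h1 hL.continuous.aestronglyMeasurable (Filter.Eventually.of_forall fun x => ?_)
  have h2 : |h x - h 0| ≤ L * ‖x‖ := by simpa [Real.dist_eq] using hL.dist_le_mul x 0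
  have h3 : |h x| ≤ |h x - h 0| + |h 0| := by simpa using abs_add_le (h x - h 0) (h 0)
  exact (h3.trans (by linarith)).trans (le_abs_self _)

/-- The product Gaussian is rotation invariant, so θ drops out. For fixed x, the derivative at x
applied to y is a centred Gaussian variable of variance ‖Dh(x)‖² ≤ L². -/
theorem lintegral_fderiv_rotation_le {h : E → ℝ} {L : NNReal} (hL : LipschitzWith L h)
    (hc : ContDiff ℝ 1 h) (θ : ℝ) :
    ∫⁻ z, ENNReal.ofReal ((fderiv ℝ h (ContinuousLinearMap.rotation θ z).1
      (ContinuousLinearMap.rotation θ z).2) ^ 2) ∂((stdGaussian E).prod (stdGaussian E))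
      ≤ ENNReal.ofReal (L ^ 2) := by
  have hfc : Continuous (fderiv ℝ h) := hc.continuous_fderiv (by norm_num)
  have hm : Measurable fun z : E × E => ENNReal.ofReal ((fderiv ℝ h z.1 z.2) ^ 2) := by
    refine ENNReal.measurable_ofReal.comp (Continuous.measurable ?_)
    exact ((hfc.comp continuous_fst).clm_apply continuous_snd).pow 2
  rw [← lintegral_map (μ := (stdGaussian E).prod (stdGaussian E)) hm
      (ContinuousLinearMap.rotation θ : E × E →L[ℝ] E × E).continuous.measurable,
    IsGaussian.map_rotation_eq_self (by simp), lintegral_prod _ hm.aemeasurable]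
  have hx : ∀ x : E, ∫⁻ y, ENNReal.ofReal ((fderiv ℝ h x y) ^ 2) ∂(stdGaussian E)
      ≤ ENNReal.ofReal (L ^ 2) := fun x => by
    rw [← ofReal_integral_eq_lintegral_ofReal]
    · refine ENNReal.ofReal_le_ofReal ?_
      have hv := variance_dual_stdGaussian (fderiv ℝ h x)
      rw [variance_of_integral_eq_zero (by fun_prop) (by simp)] at hv
      rw [hv]
      have := norm_fderiv_le_of_lipschitz ℝ hL (x₀ := x)
      gcongr
    · exact ((IsGaussian.memLp_dual _ (fderiv ℝ h x) 2 (by simp)).integrable_sq)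
    · exact Filter.Eventually.of_forall fun y => sq_nonneg _
  calc _ ≤ ∫⁻ _ : E, ENNReal.ofReal (L ^ 2) ∂(stdGaussian E) := lintegral_mono hx
    _ = _ := by simp

/-- The Gaussian Poincaré inequality, with constant `π²/8`, for `C¹` Lipschitz functions. -/
theorem variance_le_of_lipschitz_of_contDiff {h : E → ℝ} {L : NNReal} (hL : LipschitzWith L h)
    (hc : ContDiff ℝ 1 h) : Var[h; stdGaussian E] ≤ Real.pi ^ 2 / 8 * L ^ 2 := by
  set μ := stdGaussian E with hμ
  have hfc : Continuous (fderiv ℝ h) := hc.continuous_fderiv (by norm_num)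
  have h2 := two_mul_variance_eq_integral_prod (lipschitz_memLp_two hL)
  have hrc : Continuous fun p : (E × E) × ℝ =>
      fderiv ℝ h (ContinuousLinearMap.rotation p.2 p.1).1
        (ContinuousLinearMap.rotation p.2 p.1).2 := by
    simp only [ContinuousLinearMap.rotation_apply]
    exact (hfc.comp (by fun_prop)).clm_apply (by fun_prop)
  have hpi : (0 : ℝ) ≤ Real.pi / 2 := by positivity
  -- With `∫⁻`, swapping z and θ requires only measurability. The left side is 2 Var h, which halves
  -- (π/2)² to π²/8.
  have key : ∫⁻ z, ENNReal.ofReal ((h z.1 - h z.2) ^ 2) ∂(μ.prod μ)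
      ≤ ENNReal.ofReal ((Real.pi / 2) ^ 2 * L ^ 2) := by
    calc _ ≤ ∫⁻ z, (∫⁻ θ in Set.Ioc (0 : ℝ) (Real.pi / 2), ENNReal.ofReal (Real.pi / 2) *
            ENNReal.ofReal ((fderiv ℝ h (ContinuousLinearMap.rotation θ z).1
              (ContinuousLinearMap.rotation θ z).2) ^ 2)) ∂(μ.prod μ) := by
          refine lintegral_mono fun z => ?_
          refine (ENNReal.ofReal_le_ofReal (sq_sub_le_integral_rotation hc z)).trans ?_
          have hz : Continuous fun θ : ℝ => (fderiv ℝ h (ContinuousLinearMap.rotation θ z).1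
              (ContinuousLinearMap.rotation θ z).2) ^ 2 :=
            (hrc.comp (by fun_prop : Continuous fun θ : ℝ => (z, θ))).pow 2
          rw [ENNReal.ofReal_mul hpi, intervalIntegral.integral_of_le hpi,
            ofReal_integral_eq_lintegral_ofReal
              ((intervalIntegrable_iff_integrableOn_Ioc_of_le hpi).1 (hz.intervalIntegrable _ _))
              (Filter.Eventually.of_forall fun y => sq_nonneg _),
            lintegral_const_mul _ (by fun_prop)]
      _ = ∫⁻ θ in Set.Ioc (0 : ℝ) (Real.pi / 2), ∫⁻ z, ENNReal.ofReal (Real.pi / 2) *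
            ENNReal.ofReal ((fderiv ℝ h (ContinuousLinearMap.rotation θ z).1
              (ContinuousLinearMap.rotation θ z).2) ^ 2) ∂(μ.prod μ) := by
          refine lintegral_lintegral_swap ?_
          refine Measurable.aemeasurable ?_
          refine Measurable.const_mul (ENNReal.measurable_ofReal.comp ?_) _
          exact (hrc.pow 2).measurable
      _ ≤ ∫⁻ θ in Set.Ioc (0 : ℝ) (Real.pi / 2),
            ENNReal.ofReal (Real.pi / 2) * ENNReal.ofReal (L ^ 2) := by
          refine lintegral_mono fun θ => ?_
          rw [lintegral_const_mul' _ _ ENNReal.ofReal_ne_top]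
          gcongr
          exact lintegral_fderiv_rotation_le hL hc θ
      _ = _ := by
          simp only [lintegral_const, MeasurableSet.univ, Measure.restrict_apply, Set.univ_inter,
            Real.volume_Ioc, sub_zero]
          rw [← ENNReal.ofReal_mul hpi, ← ENNReal.ofReal_mul (by positivity)]
          congr 1; ring
  have hint : ∫ z, (h z.1 - h z.2) ^ 2 ∂(μ.prod μ) ≤ (Real.pi / 2) ^ 2 * L ^ 2 := by
    rw [integral_eq_lintegral_of_nonneg_ae (Filter.Eventually.of_forall fun y => sq_nonneg _)]
    · exact ENNReal.toReal_le_of_le_ofReal (by positivity) key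
    · have := hL.continuous
      exact Continuous.aestronglyMeasurable (by fun_prop)
  rw [← h2] at hint
  nlinarith

/-- A Lipschitz function is a uniform limit of smooth functions with the same Lipschitz
constant. -/
theorem exists_contDiff_lipschitz_approx {h : E → ℝ} {L : NNReal} (hL : LipschitzWith L h)
    {ε : ℝ} (hε : 0 < ε) :
    ∃ f : E → ℝ, ContDiff ℝ 1 f ∧ LipschitzWith L f ∧ ∀ x, |f x - h x| ≤ L * ε := by
  -- Averaging against a normalised bump supported within radius ε keeps the Lipschitz constant and
  -- moves h by at most L ε.
  let φ : ContDiffBump (0 : E) := ⟨ε / 2, ε, by positivity, by linarith⟩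
  have hcs := φ.hasCompactSupport_normed (μ := (volume : Measure E))
  have hci : ∀ x, Integrable (fun t => φ.normed volume t * h (x - t)) (volume : Measure E) :=
    fun x => Continuous.integrable_of_hasCompactSupport
      (φ.continuous_normed.mul (hL.continuous.comp (by fun_prop))) hcs.mul_right
  refine ⟨convolution (φ.normed volume) h (ContinuousLinearMap.lsmul ℝ ℝ) volume, ?_, ?_, ?_⟩
  · exact hcs.contDiff_convolution_left (n := 1) _ φ.contDiff_normed
      hL.continuous.locallyIntegrable
  · refine LipschitzWith.of_dist_le_mul fun x y => ?_
    simp only [convolution, ContinuousLinearMap.lsmul_apply, smul_eq_mul, Real.dist_eq]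
    rw [← integral_sub (hci x) (hci y)]
    calc _ ≤ ∫ t, φ.normed volume t * (L * dist x y) := by
          refine (abs_integral_le_integral_abs).trans
            (integral_mono_of_nonneg (Filter.Eventually.of_forall fun t => abs_nonneg _)
              ((φ.integrable_normed).mul_const _) (Filter.Eventually.of_forall fun t => ?_))
          simp only
          rw [← mul_sub, abs_mul, abs_of_nonneg (φ.nonneg_normed t)]
          refine mul_le_mul_of_nonneg_left ?_ (φ.nonneg_normed t)
          simpa [Real.dist_eq] using hL.dist_le_mul (x - t) (y - t)
      _ = _ := by rw [integral_mul_const, φ.integral_normed, one_mul]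
  · intro x
    rw [← Real.dist_eq]
    refine φ.dist_normed_convolution_le hL.continuous.aestronglyMeasurable fun y hy => ?_
    refine (hL.dist_le_mul y x).trans ?_
    have : dist y x < ε := hy
    gcongr

theorem variance_le_integral_sub_sq {Ω : Type*} [MeasurableSpace Ω] {μ : Measure Ω}
    [IsProbabilityMeasure μ] {X : Ω → ℝ} (hX : MemLp X 2 μ) (c : ℝ) :
    Var[X; μ] ≤ ∫ x, (X x - c) ^ 2 ∂μ := by
  rw [← variance_sub_const hX.1 c]
  exact variance_le_expectation_sq (hX.1.sub aestronglyMeasurable_const)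

/-- The Gaussian Poincaré inequality, with constant `π²/8`, for Lipschitz functions. -/
theorem variance_le_of_lipschitz {h : E → ℝ} {L : NNReal} (hL : LipschitzWith L h) :
    Var[h; stdGaussian E] ≤ Real.pi ^ 2 / 8 * L ^ 2 := by
  set μ := stdGaussian E with hμ
  set V : ℝ := Real.pi ^ 2 / 8 * L ^ 2
  have hbound : ∀ ε : ℝ, 0 < ε →
      Var[h; μ] ≤ (1 + 2 * (L * ε)) * V + 2 * (L * ε) + (L * ε) ^ 2 := fun ε hε => by
    obtain ⟨f, hfc, hfL, hfh⟩ := exists_contDiff_lipschitz_approx hL hε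
    have hf2 := lipschitz_memLp_two hfL
    set m := μ[f]
    have hsub : MemLp (fun x => f x - m) 2 μ := hf2.sub (memLp_const m)
    have hsq := hsub.integrable_sq
    have hV : ∫ x, (f x - m) ^ 2 ∂μ ≤ V := by
      rw [← variance_eq_integral hf2.1.aemeasurable]
      exact variance_le_of_lipschitz_of_contDiff hfL hfc
    have hLε : 0 ≤ L * ε := by positivity
    calc Var[h; μ] ≤ ∫ x, (h x - m) ^ 2 ∂μ :=
          variance_le_integral_sub_sq (lipschitz_memLp_two hL) m
      _ ≤ ∫ x, ((1 + 2 * (L * ε)) * (f x - m) ^ 2 + (2 * (L * ε) + (L * ε) ^ 2)) ∂μ := by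
          refine integral_mono ((lipschitz_memLp_two hL).sub (memLp_const m)).integrable_sq
            ((hsq.const_mul _).add (integrable_const _)) fun x => ?_
          have h1 := abs_le.1 (hfh x)
          set e := L * ε
          set a := f x - m
          obtain ⟨b, hb⟩ : ∃ b, b = h x - f x := ⟨_, rfl⟩
          have hb1 : -e ≤ b := by linarith
          have hb2 : b ≤ e := by linarith
          have : h x - m = a + b := by rw [hb]; ring
          simp only [this]
          have h4 : b ^ 2 ≤ e ^ 2 := sq_le_sq' hb1 hb2
          -- Avoids |a|: the cross term of (a + b)² is absorbed into a² with a factor tending to 0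
          -- with ε.
          have h5 : a * b ≤ e * (1 + a ^ 2) := by
            nlinarith [sq_nonneg (a - 1), sq_nonneg (a + 1),
              mul_nonneg (sub_nonneg.2 hb2) (sq_nonneg (a + 1)),
              mul_nonneg (by linarith : 0 ≤ b + e) (sq_nonneg (a - 1))]
          nlinarith
      _ = (1 + 2 * (L * ε)) * (∫ x, (f x - m) ^ 2 ∂μ) + (2 * (L * ε) + (L * ε) ^ 2) := by
          rw [integral_add (hsq.const_mul _) (integrable_const _), integral_const_mul]
          simp
      _ ≤ _ := by nlinarith
  have hlim : Filter.Tendsto (fun ε : ℝ => (1 + 2 * (L * ε)) * V + 2 * (L * ε) + (L * ε) ^ 2)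
      (nhdsWithin 0 (Set.Ioi 0)) (nhds V) := by
    have hc : Continuous (fun ε : ℝ => (1 + 2 * (L * ε)) * V + 2 * (L * ε) + (L * ε) ^ 2) := by
      fun_prop
    have := hc.tendsto 0
    simp only [mul_zero, add_zero, one_mul, ne_eq, OfNat.ofNat_ne_zero, not_false_eq_true,
      zero_pow] at this
    exact this.mono_left nhdsWithin_le_nhds
  exact ge_of_tendsto hlim (eventually_nhdsWithin_of_forall fun ε hε => hbound ε hε)

end GaussianPoincare

/-! ### Moments of the soft-thresholded one-dimensional Gaussian. -/

section OneDimensionalGaussian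

theorem integral_comp_abs_gaussianReal (f : ℝ → ℝ) :
    ∫ x, f |x| ∂(gaussianReal 0 1)
      = Real.sqrt (2 / Real.pi) * ∫ x in Set.Ioi (0 : ℝ), f x * Real.exp (-x ^ 2 / 2) := by
  rw [integral_gaussianReal_eq_integral_smul (by norm_num)]
  have h : (fun x : ℝ => gaussianPDFReal 0 1 x • f |x|)
      = fun x => (fun y => gaussianPDFReal 0 1 y • f y) |x| := by
    ext x; simp [gaussianPDFReal]
  rw [h, integral_comp_abs (f := fun y => gaussianPDFReal 0 1 y • f y), ← integral_const_mul,
    ← integral_const_mul]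
  congr 1
  ext x
  simp only [gaussianPDFReal, NNReal.coe_one, mul_one, sub_zero, smul_eq_mul]
  have h2 : Real.sqrt (2 / Real.pi) = 2 * (Real.sqrt (2 * Real.pi))⁻¹ := by
    rw [Real.sqrt_div (by norm_num), Real.sqrt_mul (by norm_num)]
    have := Real.sq_sqrt (show (0 : ℝ) ≤ 2 by norm_num)
    field_simp
    linarith
  rw [h2]; ring

/-- Makes φ the second moment of a soft-thresholded Gaussian. For t ≥ 0 the half-line beyond t lies
inside the positive half-line onto which |x| folds the law. -/
theorem gaussTail_eq_integral {t : ℝ} (ht : 0 ≤ t) :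
    gaussTail t = ∫ x, (max (|x| - t) 0) ^ 2 ∂(gaussianReal 0 1) := by
  rw [integral_comp_abs_gaussianReal (fun y => (max (y - t) 0) ^ 2), gaussTail]
  congr 1
  rw [setIntegral_eq_of_subset_of_forall_sdiff_eq_zero (s := Set.Ioi t) measurableSet_Ioi
    (Set.Ioi_subset_Ioi ht)]
  · refine setIntegral_congr_fun measurableSet_Ioi fun x hx => ?_
    rw [max_eq_left (by linarith [Set.mem_Ioi.1 hx])]
  · rintro x ⟨-, hx⟩
    rw [max_eq_right (by linarith [Set.notMem_Ioi.1 hx])]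
    simp

theorem integral_abs_gaussianReal : ∫ x, |x| ∂(gaussianReal 0 1) = Real.sqrt (2 / Real.pi) := by
  rw [integral_comp_abs_gaussianReal (fun y => y)]
  have h := integral_Ioi_of_hasDerivAt_of_nonneg' (a := 0) (l := 0)
    (g := fun x : ℝ => -Real.exp (-x ^ 2 / 2)) (g' := fun x => x * Real.exp (-x ^ 2 / 2)) ?_ ?_ ?_
  · rw [h]; simp
  · intro x _
    have h1 : HasDerivAt (fun x : ℝ => -x ^ 2 / 2) (-x) x := by
      have := ((hasDerivAt_pow 2 x).neg).div_const 2
      refine this.congr_deriv ?_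
      norm_num; ring
    exact h1.exp.neg.congr_deriv (by ring)
  · intro x hx
    have : 0 < x := hx
    positivity
  · have h1 : Filter.Tendsto (fun x : ℝ => -x ^ 2 / 2) Filter.atTop Filter.atBot := by
      have := (Filter.tendsto_pow_atTop (α := ℝ) (two_ne_zero)).atTop_div_const
        (by norm_num : (0 : ℝ) < 2)
      refine (Filter.tendsto_neg_atTop_atBot.comp this).congr fun x => ?_
      simp [neg_div]
    simpa using (Real.tendsto_exp_atBot.comp h1).neg

theorem memLp_two_id_gaussianReal : MemLp (fun x : ℝ => x) 2 (gaussianReal 0 1) :=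
  IsGaussian.memLp_two_id

theorem memLp_two_softAbs (t : ℝ) : MemLp (fun x : ℝ => max (|x| - t) 0) 2 (gaussianReal 0 1) := by
  have h : MemLp (fun x : ℝ => |x| + |t|) 2 (gaussianReal 0 1) :=
    memLp_two_id_gaussianReal.norm.add (memLp_const |t|)
  refine h.mono (Continuous.aestronglyMeasurable (by fun_prop))
    (Filter.Eventually.of_forall fun x => ?_)
  simp only [Real.norm_eq_abs]
  rw [abs_of_nonneg (le_max_right _ _)]
  exact (max_le (by linarith [neg_abs_le t]) (by positivity)).trans (le_abs_self (|x| + |t|))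

theorem integral_sq_gaussianReal : ∫ x, x ^ 2 ∂(gaussianReal 0 1) = 1 := by
  have h := variance_id_gaussianReal (μ := 0) (v := 1)
  rw [variance_of_integral_eq_zero (by fun_prop) (by simp)] at h
  simpa using h

/-- Soft thresholding is a contraction of |x|, so it cannot increase the variance, and Var |x| = 1 -
2/π. The comparison centre is the image of the mean of |x|, not the true mean. -/
theorem variance_softAbs_le (t : ℝ) :
    Var[fun x : ℝ => max (|x| - t) 0; gaussianReal 0 1] ≤ 1 - 2 / Real.pi := by
  set m := Real.sqrt (2 / Real.pi) with hm
  have habs : MemLp (fun x : ℝ => |x|) 2 (gaussianReal 0 1) := memLp_two_id_gaussianReal.norm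
  have hvar : ∫ x, (|x| - m) ^ 2 ∂(gaussianReal 0 1) = 1 - 2 / Real.pi := by
    rw [hm, ← integral_abs_gaussianReal, ← variance_eq_integral habs.1.aemeasurable,
      variance_eq_sub habs, integral_abs_gaussianReal]
    simp only [Pi.pow_apply, sq_abs, integral_sq_gaussianReal]
    rw [Real.sq_sqrt (by positivity)]
  rw [← hvar]
  refine (variance_le_integral_sub_sq (memLp_two_softAbs t) (max (m - t) 0)).trans ?_
  refine integral_mono ((memLp_two_softAbs t).sub (memLp_const _)).integrable_sq
    (habs.sub (memLp_const m)).integrable_sq fun x => ?_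
  refine sq_le_sq.2 ?_
  refine (abs_max_sub_max_le_abs _ _ _).trans_eq ?_
  congr 1; ring

end OneDimensionalGaussian

/-! ### The descent cone, its projection and the optimal scale. -/

section DescentCone

theorem sign_mul_self_eq_abs (a : ℝ) : Real.sign a * a = |a| := by
  rcases lt_trichotomy a 0 with h | h | h
  · rw [Real.sign_of_neg h, abs_of_neg h]; ring
  · simp [h]
  · rw [Real.sign_of_pos h, abs_of_pos h]; ring

theorem sign_mul_sign_of_ne_zero {a : ℝ} (ha : a ≠ 0) : Real.sign a * Real.sign a = 1 := by
  rcases Real.sign_apply_eq_of_ne_zero a ha with h | h <;> rw [h] <;> norm_num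

variable {d : ℕ}

/-- The `j`-th coordinate, up to sign, of `g` minus its projection onto `t` times the
subdifferential of the weighted `ℓ¹`-norm at `x₀`. -/
noncomputable def coneResidual (x₀ : EuclideanSpace ℝ (Fin d)) (w : Fin d → ℝ) (t : ℝ)
    (g : EuclideanSpace ℝ (Fin d)) (j : Fin d) : ℝ :=
  if x₀ j = 0 then max (|g j| - t * w j) 0 else Real.sign (x₀ j) * g j - t * w j

/-- The squared distance of `g` to `t` times the subdifferential. -/
noncomputable def scaledSqDist (x₀ : EuclideanSpace ℝ (Fin d)) (w : Fin d → ℝ) (t : ℝ)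
    (g : EuclideanSpace ℝ (Fin d)) : ℝ :=
  ∑ j, coneResidual x₀ w t g j ^ 2

/-- Minus half the derivative of `scaledSqDist` in `t`. At `t = 0` it is the directional derivative
of the weighted `ℓ¹`-norm at `x₀` in direction `g`. -/
noncomputable def scaledSlope (x₀ : EuclideanSpace ℝ (Fin d)) (w : Fin d → ℝ) (t : ℝ)
    (g : EuclideanSpace ℝ (Fin d)) : ℝ :=
  ∑ j, w j * coneResidual x₀ w t g j

/-- The squared norm of the weights on the support of `x₀`. -/
noncomputable def supportEnergy (x₀ : EuclideanSpace ℝ (Fin d)) (w : Fin d → ℝ) : ℝ :=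
  ∑ j, if x₀ j = 0 then 0 else w j ^ 2

/-- `g` minus its projection onto `t` times the subdifferential. -/
noncomputable def residualPoint (x₀ : EuclideanSpace ℝ (Fin d)) (w : Fin d → ℝ) (t : ℝ)
    (g : EuclideanSpace ℝ (Fin d)) : EuclideanSpace ℝ (Fin d) :=
  WithLp.toLp 2 fun j =>
    (if x₀ j = 0 then Real.sign (g j) else Real.sign (x₀ j)) * coneResidual x₀ w t g j

/-- First-order optimality of `t` for minimizing `scaledSqDist` over `t ≥ 0`. -/
def IsOptimalScale (x₀ : EuclideanSpace ℝ (Fin d)) (w : Fin d → ℝ) (t : ℝ)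
    (g : EuclideanSpace ℝ (Fin d)) : Prop :=
  0 ≤ t ∧ scaledSlope x₀ w t g ≤ 0 ∧ t * scaledSlope x₀ w t g = 0

variable {x₀ : EuclideanSpace ℝ (Fin d)} {w : Fin d → ℝ}

theorem supportEnergy_nonneg : 0 ≤ supportEnergy x₀ w :=
  Finset.sum_nonneg fun j _ => by split_ifs <;> positivity

theorem residual_zero_eq (v : EuclideanSpace ℝ (Fin d)) (j : Fin d) :
    coneResidual x₀ w 0 v j = if x₀ j = 0 then |v j| else Real.sign (x₀ j) * v j := by
  simp [coneResidual]

/-- A descent step bounds the directional derivative by the subgradient inequality. Conversely, for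
small τ no sign on the support flips, so the norm is exactly linear along the step. In particular
the cone is already closed. -/
theorem descentCone_weightedL1 (hw : ∀ j, 0 ≤ w j) :
    descentCone (weightedL1 w) x₀ = {v | scaledSlope x₀ w 0 v ≤ 0} := by
  ext v
  simp only [descentCone, Set.mem_ofPred_eq, weightedL1, PiLp.add_apply, PiLp.smul_apply,
    smul_eq_mul]
  constructor
  · rintro ⟨τ, hτ, h⟩
    have h1 : τ * scaledSlope x₀ w 0 v ≤ 0 := by
      have h2 : τ * scaledSlope x₀ w 0 v ≤ ∑ j, (w j * |x₀ j + τ * v j| - w j * |x₀ j|) := by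
        rw [scaledSlope, Finset.mul_sum]
        refine Finset.sum_le_sum fun j _ => ?_
        have h3 : τ * coneResidual x₀ w 0 v j ≤ |x₀ j + τ * v j| - |x₀ j| := by
          rw [residual_zero_eq]
          split_ifs with hx
          · simp [hx, abs_mul, abs_of_pos hτ]
          · have h4 : Real.sign (x₀ j) * (x₀ j + τ * v j) ≤ |x₀ j + τ * v j| := by
              rcases Real.sign_apply_eq_of_ne_zero _ hx with h | h <;> rw [h]
              · linarith [neg_abs_le (x₀ j + τ * v j)]
              · linarith [le_abs_self (x₀ j + τ * v j)]
            have h5 := sign_mul_self_eq_abs (x₀ j)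
            linarith
        nlinarith [mul_le_mul_of_nonneg_left h3 (hw j)]
      rw [Finset.sum_sub_distrib] at h2
      linarith
    exact nonpos_of_mul_nonpos_right h1 hτ
  · intro h
    have hev : ∀ᶠ τ : ℝ in nhdsWithin 0 (Set.Ioi 0), ∀ j, x₀ j ≠ 0 → τ * |v j| < |x₀ j| := by
      refine Filter.eventually_all.2 fun j => ?_
      by_cases hx : x₀ j = 0
      · simp [hx]
      · have hc : Continuous fun τ : ℝ => τ * |v j| := by fun_prop
        have := (hc.tendsto 0).eventually_lt_const (by simpa using hx : 0 * |v j| < |x₀ j|)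
        filter_upwards [nhdsWithin_le_nhds this] with τ hτ _ using hτ
    obtain ⟨τ, hτ, hτ0⟩ := (hev.and self_mem_nhdsWithin).exists
    have hτ0 : 0 < τ := hτ0
    refine ⟨τ, hτ0, ?_⟩
    have h2 : ∑ j, (w j * |x₀ j + τ * v j| - w j * |x₀ j|) = τ * scaledSlope x₀ w 0 v := by
      rw [scaledSlope, Finset.mul_sum]
      refine Finset.sum_congr rfl fun j _ => ?_
      have h3 : |x₀ j + τ * v j| - |x₀ j| = τ * coneResidual x₀ w 0 v j := by
        rw [residual_zero_eq]
        split_ifs with hx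
        · simp [hx, abs_mul, abs_of_pos hτ0]
        · have h4 := hτ j hx
          rw [show τ * |v j| = |τ * v j| by rw [abs_mul, abs_of_pos hτ0]] at h4
          have h5 := neg_abs_le (τ * v j)
          have h6 := le_abs_self (τ * v j)
          rcases lt_or_gt_of_ne hx with h | h
          · rw [abs_of_neg h] at h4 ⊢
            rw [Real.sign_of_neg h, abs_of_neg (by linarith)]; ring
          · rw [abs_of_pos h] at h4 ⊢
            rw [Real.sign_of_pos h, abs_of_pos (by linarith)]; ring
      rw [← mul_sub, h3]; ring
    rw [Finset.sum_sub_distrib] at h2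
    nlinarith

theorem continuous_residual (t : ℝ) (j : Fin d) : Continuous fun g => coneResidual x₀ w t g j := by
  unfold coneResidual
  split_ifs <;> fun_prop

theorem continuous_residual_scale (g : EuclideanSpace ℝ (Fin d)) (j : Fin d) :
    Continuous fun t => coneResidual x₀ w t g j := by
  unfold coneResidual
  split_ifs <;> fun_prop

theorem continuous_scaledSlope (t : ℝ) : Continuous (scaledSlope x₀ w t) :=
  continuous_finsetSum _ fun j _ => continuous_const.mul (continuous_residual t j)

theorem continuous_scaledSlope_scale (g : EuclideanSpace ℝ (Fin d)) :
    Continuous fun t => scaledSlope x₀ w t g :=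
  continuous_finsetSum _ fun j _ => continuous_const.mul (continuous_residual_scale g j)

theorem isClosed_descentCone (hw : ∀ j, 0 ≤ w j) :
    IsClosed (descentCone (weightedL1 w) x₀) := by
  rw [descentCone_weightedL1 hw]
  exact isClosed_le (continuous_scaledSlope 0) continuous_const

theorem convex_descentCone (hw : ∀ j, 0 ≤ w j) :
    Convex ℝ (descentCone (weightedL1 w) x₀) := by
  rw [descentCone_weightedL1 hw]
  intro u hu v hv a b ha hb _
  simp only [Set.mem_ofPred_eq] at *
  have h : scaledSlope x₀ w 0 (a • u + b • v)
      ≤ a * scaledSlope x₀ w 0 u + b * scaledSlope x₀ w 0 v := by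
    simp only [scaledSlope, Finset.mul_sum, ← Finset.sum_add_distrib]
    refine Finset.sum_le_sum fun j _ => ?_
    have h1 : coneResidual x₀ w 0 (a • u + b • v) j
        ≤ a * coneResidual x₀ w 0 u j + b * coneResidual x₀ w 0 v j := by
      simp only [residual_zero_eq, PiLp.add_apply, PiLp.smul_apply, smul_eq_mul]
      split_ifs with hx
      · refine (abs_add_le _ _).trans_eq ?_
        rw [abs_mul, abs_mul, abs_of_nonneg ha, abs_of_nonneg hb]
      · exact le_of_eq (by ring)
    nlinarith [mul_le_mul_of_nonneg_left h1 (hw j)]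
  nlinarith

theorem residual_nonneg_of_eq_zero {t : ℝ} {g : EuclideanSpace ℝ (Fin d)} {j : Fin d}
    (hx : x₀ j = 0) : 0 ≤ coneResidual x₀ w t g j := by
  simp [coneResidual, hx]

theorem residual_eq_zero_of_eq_zero (hw : ∀ j, 0 ≤ w j) {t : ℝ} (ht : 0 ≤ t)
    {g : EuclideanSpace ℝ (Fin d)} {j : Fin d} (hx : x₀ j = 0) (hg : g j = 0) :
    coneResidual x₀ w t g j = 0 := by
  simp [coneResidual, hx, hg, mul_nonneg ht (hw j)]

theorem norm_sq_residualPoint (hw : ∀ j, 0 ≤ w j) {t : ℝ} (ht : 0 ≤ t)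
    (g : EuclideanSpace ℝ (Fin d)) :
    ‖residualPoint x₀ w t g‖ ^ 2 = scaledSqDist x₀ w t g := by
  rw [EuclideanSpace.real_norm_sq_eq, scaledSqDist]
  refine Finset.sum_congr rfl fun j _ => ?_
  simp only [residualPoint]
  split_ifs with hx
  -- `Real.sign 0 = 0` would lose the residual here, but at g j = 0 the residual itself vanishes
  -- because t w_j ≥ 0.
  · by_cases hg : g j = 0
    · simp [hg, residual_eq_zero_of_eq_zero hw ht hx hg]
    · rw [mul_pow, sq, sign_mul_sign_of_ne_zero hg, one_mul]
  · rw [mul_pow, sq, sign_mul_sign_of_ne_zero hx, one_mul]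

/-- Hence a nonpositive slope at t says precisely that the residual point lies in the descent cone.
-/
theorem scaledSlope_residualPoint (hw : ∀ j, 0 ≤ w j) {t : ℝ} (ht : 0 ≤ t)
    (g : EuclideanSpace ℝ (Fin d)) :
    scaledSlope x₀ w 0 (residualPoint x₀ w t g) = scaledSlope x₀ w t g := by
  refine Finset.sum_congr rfl fun j _ => ?_
  congr 1
  rw [residual_zero_eq]
  simp only [residualPoint]
  split_ifs with hx
  · by_cases hg : g j = 0
    · simp [hg, residual_eq_zero_of_eq_zero hw ht hx hg]
    · rw [abs_mul, abs_of_nonneg (residual_nonneg_of_eq_zero hx)]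
      rcases Real.sign_apply_eq_of_ne_zero _ hg with h | h <;> simp [h]
  · rw [← mul_assoc, sign_mul_sign_of_ne_zero hx, one_mul]

/-- The vector g - p lies in t times the subdifferential, whose support function is t times the
directional derivative. -/
theorem inner_sub_residualPoint_le (hw : ∀ j, 0 ≤ w j) {t : ℝ} (ht : 0 ≤ t)
    (g v : EuclideanSpace ℝ (Fin d)) :
    inner ℝ (g - residualPoint x₀ w t g) v ≤ t * scaledSlope x₀ w 0 v := by
  rw [PiLp.inner_apply, scaledSlope, Finset.mul_sum]
  refine Finset.sum_le_sum fun j _ => ?_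
  simp only [residualPoint, coneResidual, PiLp.sub_apply, RCLike.inner_apply,
    conj_trivial]
  have htw := mul_nonneg ht (hw j)
  split_ifs with hx
  · have h1 : |g j - Real.sign (g j) * max (|g j| - t * w j) 0| ≤ t * w j := by
      rcases lt_trichotomy (g j) 0 with h | h | h
      · rw [Real.sign_of_neg h, abs_of_neg h, abs_le]
        rcases max_cases (-g j - t * w j) 0 with ⟨e, _⟩ | ⟨e, _⟩ <;> rw [e] <;>
          constructor <;> linarith
      · simp [h, htw]
      · rw [Real.sign_of_pos h, abs_of_pos h, abs_le]
        rcases max_cases (g j - t * w j) 0 with ⟨e, _⟩ | ⟨e, _⟩ <;> rw [e] <;>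
          constructor <;> linarith
    refine (le_abs_self _).trans ?_
    rw [abs_mul, show max (|v j| - 0 * w j) 0 = |v j| by simp]
    nlinarith [mul_le_mul_of_nonneg_left h1 (abs_nonneg (v j))]
  · have := sign_mul_sign_of_ne_zero hx
    refine le_of_eq ?_
    linear_combination (- g j * v j) * this

/-- Wherever the residual is nonzero, g - p sits at the extreme value t w_j, so p attains the
support function. -/
theorem inner_sub_residualPoint_self (hw : ∀ j, 0 ≤ w j) {t : ℝ} (ht : 0 ≤ t)
    (g : EuclideanSpace ℝ (Fin d)) :
    inner ℝ (g - residualPoint x₀ w t g) (residualPoint x₀ w t g) = t * scaledSlope x₀ w t g := by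
  rw [PiLp.inner_apply, scaledSlope, Finset.mul_sum]
  refine Finset.sum_congr rfl fun j _ => ?_
  simp only [residualPoint, coneResidual, PiLp.sub_apply, RCLike.inner_apply, conj_trivial]
  have htw := mul_nonneg ht (hw j)
  split_ifs with hx
  · rcases lt_trichotomy (g j) 0 with h | h | h
    · rw [Real.sign_of_neg h, abs_of_neg h]
      rcases max_cases (-g j - t * w j) 0 with ⟨e, _⟩ | ⟨e, _⟩ <;> rw [e] <;> ring
    · simp [h, htw]
    · rw [Real.sign_of_pos h, abs_of_pos h]
      rcases max_cases (g j - t * w j) 0 with ⟨e, _⟩ | ⟨e, _⟩ <;> rw [e] <;> ring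
  · have := sign_mul_sign_of_ne_zero hx
    linear_combination (-(Real.sign (x₀ j) * g j - t * w j) ^ 2) * this

/-- Moreau's criterion: p is in the cone, g - p is in its polar, and the two are orthogonal. -/
theorem metricProj_descentCone (hw : ∀ j, 0 ≤ w j) {t : ℝ} {g : EuclideanSpace ℝ (Fin d)}
    (h : IsOptimalScale x₀ w t g) :
    metricProj (closure (descentCone (weightedL1 w) x₀)) g = residualPoint x₀ w t g := by
  obtain ⟨ht, hs, hts⟩ := h
  rw [(isClosed_descentCone hw).closure_eq]
  refine metricProj_unique (isClosed_descentCone hw) (convex_descentCone hw) ?_ fun c hc => ?_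
  · rw [descentCone_weightedL1 hw, Set.mem_ofPred_eq, scaledSlope_residualPoint hw ht]
    exact hs
  · rw [descentCone_weightedL1 hw, Set.mem_ofPred_eq] at hc
    set p := residualPoint x₀ w t g
    have h1 : inner ℝ (g - p) c ≤ 0 :=
      (inner_sub_residualPoint_le hw ht g c).trans (mul_nonpos_of_nonneg_of_nonpos ht hc)
    have h2 : inner ℝ (g - p) p = 0 := (inner_sub_residualPoint_self hw ht g).trans hts
    have h3 : ‖c - g‖ ^ 2 = ‖c - p‖ ^ 2 - 2 * inner ℝ (g - p) (c - p) + ‖p - g‖ ^ 2 := by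
      have e : c - g = (c - p) - (g - p) := by abel
      rw [e, norm_sub_sq_real, real_inner_comm, norm_sub_rev p g]
    rw [inner_sub_right, h2] at h3
    refine le_of_sq_le_sq ?_ (norm_nonneg _)
    nlinarith [sq_nonneg ‖c - p‖]

theorem norm_sq_metricProj_descentCone (hw : ∀ j, 0 ≤ w j) {t : ℝ}
    {g : EuclideanSpace ℝ (Fin d)} (h : IsOptimalScale x₀ w t g) :
    ‖metricProj (closure (descentCone (weightedL1 w) x₀)) g‖ ^ 2 = scaledSqDist x₀ w t g := by
  rw [metricProj_descentCone hw h, norm_sq_residualPoint hw h.1]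

/-- The vector g - p is the projection onto the polar cone, hence nonexpansive in g. On the support
its coordinates are ± t w_j, so its displacement has norm at least √A |t - t'|. -/
theorem abs_sub_scale_le (hw : ∀ j, 0 ≤ w j) {t t' : ℝ} {g g' : EuclideanSpace ℝ (Fin d)}
    (h : IsOptimalScale x₀ w t g) (h' : IsOptimalScale x₀ w t' g') :
    Real.sqrt (supportEnergy x₀ w) * |t - t'| ≤ ‖g - g'‖ := by
  set p := residualPoint x₀ w t g with hp
  set p' := residualPoint x₀ w t' g' with hp'
  have h1 : inner ℝ (g - p) p = 0 := (inner_sub_residualPoint_self hw h.1 g).trans h.2.2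
  have h1' : inner ℝ (g' - p') p' = 0 := (inner_sub_residualPoint_self hw h'.1 g').trans h'.2.2
  have h2 : inner ℝ (g - p) p' ≤ 0 := (inner_sub_residualPoint_le hw h.1 g p').trans
    (mul_nonpos_of_nonneg_of_nonpos h.1 ((scaledSlope_residualPoint hw h'.1 g').trans_le h'.2.1))
  have h2' : inner ℝ (g' - p') p ≤ 0 := (inner_sub_residualPoint_le hw h'.1 g' p).trans
    (mul_nonpos_of_nonneg_of_nonpos h'.1 ((scaledSlope_residualPoint hw h.1 g).trans_le h.2.1))
  set u := (g - p) - (g' - p') with hu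
  have h3 : ‖u‖ ≤ ‖g - g'‖ := by
    have e : g - g' = u + (p - p') := by rw [hu]; abel
    have h4 : 0 ≤ inner ℝ u (p - p') := by
      rw [hu, inner_sub_left, inner_sub_right, inner_sub_right, h1, h1']
      linarith
    refine le_of_sq_le_sq ?_ (norm_nonneg _)
    rw [e, norm_add_sq_real]
    nlinarith [sq_nonneg ‖p - p'‖]
  refine le_trans (le_of_sq_le_sq ?_ (norm_nonneg u)) h3
  rw [mul_pow, Real.sq_sqrt supportEnergy_nonneg, sq_abs, EuclideanSpace.real_norm_sq_eq,
    supportEnergy, Finset.sum_mul]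
  refine Finset.sum_le_sum fun j _ => ?_
  split_ifs with hx
  · rw [zero_mul]; positivity
  · simp only [hu, hp, hp', residualPoint, coneResidual, hx, if_false, PiLp.sub_apply]
    have := sign_mul_sign_of_ne_zero hx
    refine le_of_eq ?_
    have e : g j - Real.sign (x₀ j) * (Real.sign (x₀ j) * g j - t * w j)
        - (g' j - Real.sign (x₀ j) * (Real.sign (x₀ j) * g' j - t' * w j))
        = Real.sign (x₀ j) * (w j * (t - t')) := by
      linear_combination (g' j - g j) * this
    rw [e, mul_pow, sq (Real.sign _), this]; ring

/-- On the support the residual falls linearly in t; off it, it can only decrease. The resulting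
decay rate A forces the slope to become nonpositive by t = s(0)/A. -/
theorem scaledSlope_le (hw : ∀ j, 0 ≤ w j) {t : ℝ} (ht : 0 ≤ t) (g : EuclideanSpace ℝ (Fin d)) :
    scaledSlope x₀ w t g ≤ scaledSlope x₀ w 0 g - t * supportEnergy x₀ w := by
  rw [scaledSlope, scaledSlope, supportEnergy, Finset.mul_sum, ← Finset.sum_sub_distrib]
  refine Finset.sum_le_sum fun j _ => ?_
  simp only [coneResidual]
  split_ifs with hx
  · rw [mul_zero, sub_zero]
    refine mul_le_mul_of_nonneg_left (max_le_max ?_ le_rfl) (hw j)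
    have := mul_nonneg ht (hw j)
    linarith
  · exact le_of_eq (by ring)

theorem exists_isOptimalScale (hw : ∀ j, 0 ≤ w j) (hA : 0 < supportEnergy x₀ w)
    (g : EuclideanSpace ℝ (Fin d)) : ∃ t, IsOptimalScale x₀ w t g := by
  by_cases h0 : scaledSlope x₀ w 0 g ≤ 0
  · exact ⟨0, le_rfl, h0, zero_mul _⟩
  · push Not at h0
    set b := scaledSlope x₀ w 0 g / supportEnergy x₀ w
    have hb : 0 ≤ b := by positivity
    have h1 : scaledSlope x₀ w b g ≤ 0 := by
      have := scaledSlope_le (x₀ := x₀) hw hb g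
      rwa [div_mul_cancel₀ _ hA.ne', sub_self] at this
    obtain ⟨t, ht, hts⟩ := intermediate_value_Icc' hb
      (continuous_scaledSlope_scale (x₀ := x₀) (w := w) g).continuousOn ⟨h1, h0.le⟩
    simp only at hts
    exact ⟨t, ht.1, hts.le, by rw [hts, mul_zero]⟩

/-- Each off-support term is convex in t and each support term is a quadratic with leading
coefficient w_j², which supplies the A (t' - t)² gain. -/
theorem scaledSqDist_ge (t t' : ℝ) (g : EuclideanSpace ℝ (Fin d)) :
    scaledSqDist x₀ w t g - 2 * scaledSlope x₀ w t g * (t' - t)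
      + supportEnergy x₀ w * (t' - t) ^ 2 ≤ scaledSqDist x₀ w t' g := by
  rw [scaledSqDist, scaledSqDist, scaledSlope, supportEnergy, Finset.mul_sum, Finset.sum_mul,
    Finset.sum_mul, ← Finset.sum_sub_distrib, ← Finset.sum_add_distrib]
  refine Finset.sum_le_sum fun j _ => ?_
  simp only [coneResidual]
  split_ifs with hx
  · rcases max_cases (|g j| - t * w j) 0 with ⟨e, _⟩ | ⟨e, _⟩ <;>
    rcases max_cases (|g j| - t' * w j) 0 with ⟨e', _⟩ | ⟨e', _⟩ <;> rw [e, e'] <;>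
    nlinarith [sq_nonneg (w j * (t' - t)), sq_nonneg (|g j| - t' * w j), sq_nonneg (|g j| - t * w j)]
  · exact le_of_eq (by ring)

theorem IsOptimalScale.scaledSqDist_le {t : ℝ} {g : EuclideanSpace ℝ (Fin d)}
    (h : IsOptimalScale x₀ w t g) {t' : ℝ} (ht' : 0 ≤ t') :
    scaledSqDist x₀ w t g ≤ scaledSqDist x₀ w t' g := by
  have h1 := scaledSqDist_ge (x₀ := x₀) (w := w) t t' g
  have h2 := mul_nonneg (supportEnergy_nonneg (x₀ := x₀) (w := w)) (sq_nonneg (t' - t))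
  nlinarith [h.2.1, h.2.2, mul_nonneg ht' (neg_nonneg.2 h.2.1)]

end DescentCone

/-! ### Means and variances under the standard Gaussian. -/

section Expectations

variable {d : ℕ} {x₀ : EuclideanSpace ℝ (Fin d)} {w : Fin d → ℝ}

theorem measurePreserving_coord_stdGaussian (j : Fin d) :
    MeasurePreserving (fun g : EuclideanSpace ℝ (Fin d) => g j)
      (stdGaussian (EuclideanSpace ℝ (Fin d))) (gaussianReal 0 1) := by
  have h : MeasurePreserving (WithLp.toLp 2 : (Fin d → ℝ) → EuclideanSpace ℝ (Fin d))
      (Measure.pi fun _ => gaussianReal 0 1) (stdGaussian (EuclideanSpace ℝ (Fin d))) :=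
    ⟨by fun_prop, map_pi_eq_stdGaussian⟩
  refine ⟨by fun_prop, ?_⟩
  rw [← h.map_eq, Measure.map_map (by fun_prop) (by fun_prop)]
  exact (measurePreserving_eval (fun _ : Fin d => gaussianReal 0 1) j).map_eq

/-- The one-dimensional function underlying `coneResidual`. -/
noncomputable def coordResidual (a c y : ℝ) : ℝ :=
  if a = 0 then max (|y| - c) 0 else Real.sign a * y - c

theorem coneResidual_eq (t : ℝ) (g : EuclideanSpace ℝ (Fin d)) (j : Fin d) :
    coneResidual x₀ w t g j = coordResidual (x₀ j) (t * w j) (g j) := rfl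

theorem memLp_coordResidual (a c : ℝ) : MemLp (coordResidual a c) 2 (gaussianReal 0 1) := by
  unfold coordResidual
  split_ifs with h
  · exact memLp_two_softAbs c
  · exact (memLp_two_id_gaussianReal.const_mul _).sub (memLp_const c)

theorem integral_sign_mul_sub (a c : ℝ) :
    ∫ y, (Real.sign a * y - c) ∂(gaussianReal 0 1) = -c := by
  have hi : Integrable (fun y : ℝ => Real.sign a * y) (gaussianReal 0 1) :=
    (memLp_two_id_gaussianReal.integrable (by norm_num)).const_mul _
  rw [integral_sub hi (integrable_const _), integral_const_mul]
  simp

theorem neg_le_integral_coordResidual (a : ℝ) {c : ℝ} (hc : 0 ≤ c) :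
    -c ≤ ∫ y, coordResidual a c y ∂(gaussianReal 0 1) := by
  by_cases h : a = 0
  · simp only [coordResidual, h, if_true]
    exact (neg_nonpos.2 hc).trans (integral_nonneg fun y => le_max_right _ _)
  · simp only [coordResidual, h, if_false]
    exact (integral_sign_mul_sub a c).ge

theorem integral_coordResidual_sq (a : ℝ) {c : ℝ} (hc : 0 ≤ c) :
    ∫ y, coordResidual a c y ^ 2 ∂(gaussianReal 0 1)
      = if a = 0 then gaussTail c else 1 + c ^ 2 := by
  split_ifs with h
  · simp only [coordResidual, h, if_true, gaussTail_eq_integral hc]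
  · simp only [coordResidual, h, if_false]
    have e : (fun y : ℝ => (Real.sign a * y - c) ^ 2)
        = fun y => y ^ 2 - 2 * c * (Real.sign a * y - c) - c ^ 2 := by
      ext y
      linear_combination y ^ 2 * sign_mul_sign_of_ne_zero h
    have hi : Integrable (fun y : ℝ => Real.sign a * y - c) (gaussianReal 0 1) :=
      ((memLp_two_id_gaussianReal.const_mul _).sub (memLp_const c)).integrable (by norm_num)
    have h2 : Integrable (fun y : ℝ => y ^ 2) (gaussianReal 0 1) :=
      memLp_two_id_gaussianReal.integrable_sq
    have h3 : Integrable (fun y : ℝ => y ^ 2 - 2 * c * (Real.sign a * y - c)) (gaussianReal 0 1) :=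
      h2.sub (hi.const_mul _)
    rw [e, integral_sub h3 (integrable_const _), integral_sub h2 (hi.const_mul _),
      integral_const_mul, integral_sign_mul_sub, integral_sq_gaussianReal]
    simp only [integral_const, probReal_univ, smul_eq_mul]
    ring

theorem variance_coordResidual_le (a c : ℝ) :
    Var[coordResidual a c; gaussianReal 0 1] ≤ if a = 0 then 1 - 2 / Real.pi else 1 := by
  split_ifs with h
  · have e : coordResidual a c = fun y => max (|y| - c) 0 := by ext y; simp [coordResidual, h]
    rw [e]
    exact variance_softAbs_le c
  · refine (variance_le_integral_sub_sq (memLp_coordResidual a c) (-c)).trans_eq ?_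
    rw [← integral_sq_gaussianReal]
    congr 1
    ext y
    simp only [coordResidual, h, if_false]
    linear_combination y ^ 2 * sign_mul_sign_of_ne_zero h

theorem memLp_coneResidual (t : ℝ) (j : Fin d) :
    MemLp (fun g => coneResidual x₀ w t g j) 2 (stdGaussian (EuclideanSpace ℝ (Fin d))) :=
  (memLp_coordResidual (x₀ j) (t * w j)).comp_measurePreserving
    (measurePreserving_coord_stdGaussian j)

theorem integral_comp_coord (f : ℝ → ℝ) (hf : AEStronglyMeasurable f (gaussianReal 0 1))
    (j : Fin d) :
    ∫ g : EuclideanSpace ℝ (Fin d), f (g j) ∂(stdGaussian (EuclideanSpace ℝ (Fin d)))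
      = ∫ y, f y ∂(gaussianReal 0 1) := by
  have h := measurePreserving_coord_stdGaussian j
  rw [← h.map_eq] at hf ⊢
  exact (integral_map h.measurable.aemeasurable hf).symm

theorem memLp_scaledSlope (t : ℝ) :
    MemLp (scaledSlope x₀ w t) 2 (stdGaussian (EuclideanSpace ℝ (Fin d))) :=
  memLp_finsetSum _ fun j _ => (memLp_coneResidual t j).const_mul (w j)

theorem integrable_scaledSqDist (t : ℝ) :
    Integrable (scaledSqDist x₀ w t) (stdGaussian (EuclideanSpace ℝ (Fin d))) :=
  integrable_finsetSum _ fun j _ => (memLp_coneResidual t j).integrable_sq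

theorem integral_scaledSqDist (hw : ∀ j, 0 ≤ w j) {t : ℝ} (ht : 0 ≤ t) :
    ∫ g, scaledSqDist x₀ w t g ∂(stdGaussian (EuclideanSpace ℝ (Fin d)))
      = ∑ j, if x₀ j = 0 then gaussTail (t * w j) else 1 + (t * w j) ^ 2 := by
  simp only [scaledSqDist]
  rw [integral_finsetSum _ fun j _ => (memLp_coneResidual t j).integrable_sq]
  refine Finset.sum_congr rfl fun j _ => ?_
  simp only [coneResidual_eq]
  rw [integral_comp_coord (fun y => coordResidual (x₀ j) (t * w j) y ^ 2)
    ((memLp_coordResidual _ _).1.pow 2), integral_coordResidual_sq _ (mul_nonneg ht (hw j))]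

theorem neg_le_integral_scaledSlope (hw : ∀ j, 0 ≤ w j) {t : ℝ} (ht : 0 ≤ t) :
    -(t * ∑ j, w j ^ 2) ≤ ∫ g, scaledSlope x₀ w t g ∂(stdGaussian (EuclideanSpace ℝ (Fin d))) := by
  simp only [scaledSlope]
  rw [integral_finsetSum _ fun j _ =>
    ((memLp_coneResidual t j).integrable (by norm_num)).const_mul _, Finset.mul_sum,
    ← Finset.sum_neg_distrib]
  refine Finset.sum_le_sum fun j _ => ?_
  simp only [coneResidual_eq]
  rw [integral_const_mul, integral_comp_coord _ (memLp_coordResidual _ _).1]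
  nlinarith [mul_le_mul_of_nonneg_left
    (neg_le_integral_coordResidual (x₀ j) (mul_nonneg ht (hw j))) (hw j)]

/-- The summands depend on independent coordinates: each contributes at most w_j² on the support,
and (1 - 2/π) w_j² off it. -/
theorem variance_scaledSlope_le (t : ℝ) :
    Var[scaledSlope x₀ w t; stdGaussian (EuclideanSpace ℝ (Fin d))]
      ≤ supportEnergy x₀ w + (1 - 2 / Real.pi) * (∑ j, w j ^ 2 - supportEnergy x₀ w) := by
  have hX : ∀ j, MemLp (fun y => w j * coordResidual (x₀ j) (t * w j) y) 2 (gaussianReal 0 1) :=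
    fun j => (memLp_coordResidual _ _).const_mul _
  have h1 : Var[scaledSlope x₀ w t; stdGaussian (EuclideanSpace ℝ (Fin d))]
      = ∑ j, Var[fun y => w j * coordResidual (x₀ j) (t * w j) y; gaussianReal 0 1] := by
    rw [← variance_sum_pi hX, ← map_pi_eq_stdGaussian,
      variance_map (continuous_scaledSlope t).aemeasurable (by fun_prop)]
    congr 1
    ext g
    simp [scaledSlope, coneResidual_eq]
  rw [h1, supportEnergy, ← Finset.sum_sub_distrib, Finset.mul_sum, ← Finset.sum_add_distrib]
  refine Finset.sum_le_sum fun j _ => ?_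
  rw [variance_const_mul]
  refine (mul_le_mul_of_nonneg_left (variance_coordResidual_le _ _) (sq_nonneg _)).trans_eq ?_
  split_ifs <;> ring

theorem abs_scaledSlope_sub_le (hw : ∀ j, 0 ≤ w j) (t t' : ℝ) (g : EuclideanSpace ℝ (Fin d)) :
    |scaledSlope x₀ w t g - scaledSlope x₀ w t' g| ≤ (∑ j, w j ^ 2) * |t - t'| := by
  rw [scaledSlope, scaledSlope, ← Finset.sum_sub_distrib, Finset.sum_mul]
  refine (Finset.abs_sum_le_sum_abs _ _).trans (Finset.sum_le_sum fun j _ => ?_)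
  have h : |coneResidual x₀ w t g j - coneResidual x₀ w t' g j| ≤ w j * |t - t'| := by
    have e : w j * |t - t'| = |t' * w j - t * w j| := by
      rw [← sub_mul, abs_mul, abs_of_nonneg (hw j), abs_sub_comm, mul_comm]
    rw [e]
    unfold coneResidual
    split_ifs
    · refine (abs_max_sub_max_le_abs _ _ _).trans_eq ?_
      congr 1; ring
    · exact le_of_eq (by congr 1; ring)
  rw [← mul_sub, abs_mul, abs_of_nonneg (hw j), sq, mul_assoc]
  exact mul_le_mul_of_nonneg_left h (hw j)

/-- Centring the slope allows τ - t to be replaced by τ - E τ in the cross term. The mean slope is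
nonnegative at 0 and nonpositive at its initial value divided by A. -/
theorem exists_integral_scaledSlope_eq_zero (hw : ∀ j, 0 ≤ w j) (hA : 0 < supportEnergy x₀ w) :
    ∃ t, 0 ≤ t ∧ ∫ g, scaledSlope x₀ w t g ∂(stdGaussian (EuclideanSpace ℝ (Fin d))) = 0 := by
  set μ := stdGaussian (EuclideanSpace ℝ (Fin d))
  set G : ℝ → ℝ := fun t => ∫ g, scaledSlope x₀ w t g ∂μ with hG
  have hi : ∀ t, Integrable (scaledSlope x₀ w t) μ := fun t =>
    (memLp_scaledSlope t).integrable (by norm_num)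
  have hL : LipschitzWith (∑ j, w j ^ 2).toNNReal G := by
    refine LipschitzWith.of_dist_le_mul fun t t' => ?_
    rw [Real.dist_eq, Real.dist_eq, Real.coe_toNNReal _ (by positivity), hG]
    simp only
    rw [← integral_sub (hi t) (hi t')]
    refine abs_integral_le_integral_abs.trans ?_
    refine (integral_mono ((hi t).sub (hi t')).abs (integrable_const _)
      (abs_scaledSlope_sub_le hw t t')).trans_eq ?_
    simp
  have h0 : 0 ≤ G 0 := by
    have := neg_le_integral_scaledSlope (x₀ := x₀) hw le_rfl
    rwa [zero_mul, neg_zero] at this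
  set b := G 0 / supportEnergy x₀ w
  have hb : 0 ≤ b := by positivity
  have h1 : G b ≤ 0 := by
    have h2 : G b ≤ ∫ g, (scaledSlope x₀ w 0 g - b * supportEnergy x₀ w) ∂μ :=
      integral_mono (hi b) ((hi 0).sub (integrable_const _)) fun g => scaledSlope_le hw hb g
    rw [integral_sub (hi 0) (integrable_const _)] at h2
    simp only [integral_const, probReal_univ, smul_eq_mul, one_mul] at h2
    rw [div_mul_cancel₀ _ hA.ne'] at h2
    linarith
  obtain ⟨t, ht, hts⟩ := intermediate_value_Icc' hb hL.continuous.continuousOn ⟨h1, h0⟩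
  exact ⟨t, ht.1, hts⟩

end Expectations

/-! ### Comparing E min with min E. -/

section StatisticalDimension

variable {d : ℕ} {x₀ : EuclideanSpace ℝ (Fin d)} {w : Fin d → ℝ}

theorem continuous_scaledSqDist_comp {τ : EuclideanSpace ℝ (Fin d) → ℝ} (hτ : Continuous τ) :
    Continuous fun g => scaledSqDist x₀ w (τ g) g := by
  refine continuous_finsetSum _ fun j _ => Continuous.pow ?_ 2
  unfold coneResidual
  split_ifs <;> fun_prop

theorem scaledSqDist_nonneg (t : ℝ) (g : EuclideanSpace ℝ (Fin d)) :
    0 ≤ scaledSqDist x₀ w t g := Finset.sum_nonneg fun _ _ => sq_nonneg _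

theorem integrable_scaledSqDist_optimal {τ : EuclideanSpace ℝ (Fin d) → ℝ} (hτ : Continuous τ)
    (hopt : ∀ g, IsOptimalScale x₀ w (τ g) g) :
    Integrable (fun g => scaledSqDist x₀ w (τ g) g) (stdGaussian (EuclideanSpace ℝ (Fin d))) := by
  refine (integrable_scaledSqDist (x₀ := x₀) (w := w) 0).mono
    (continuous_scaledSqDist_comp hτ).aestronglyMeasurable (Filter.Eventually.of_forall fun g => ?_)
  rw [Real.norm_of_nonneg (scaledSqDist_nonneg _ _), Real.norm_of_nonneg (scaledSqDist_nonneg _ _)]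
  exact (hopt g).scaledSqDist_le le_rfl

theorem statDim_descentCone_eq (hw : ∀ j, 0 ≤ w j) {τ : EuclideanSpace ℝ (Fin d) → ℝ}
    (hopt : ∀ g, IsOptimalScale x₀ w (τ g) g) :
    statDim (descentCone (weightedL1 w) x₀)
      = ∫ g, scaledSqDist x₀ w (τ g) g ∂(stdGaussian (EuclideanSpace ℝ (Fin d))) :=
  integral_congr_ae (Filter.Eventually.of_forall fun g => norm_sq_metricProj_descentCone hw (hopt g))

/-- Disposes of the degenerate case: with zero weights every slope vanishes and scale 0 is optimal.
-/
theorem eq_zero_of_supportEnergy_eq_zero {c : ℝ} (hc : ∑ j, w j ^ 2 ≤ c * supportEnergy x₀ w)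
    (hA : supportEnergy x₀ w = 0) (j : Fin d) : w j = 0 := by
  rw [hA, mul_zero] at hc
  have := (Finset.sum_eq_zero_iff_of_nonneg fun j _ => sq_nonneg (w j)).1
    (le_antisymm hc (Finset.sum_nonneg fun j _ => sq_nonneg (w j))) j (Finset.mem_univ j)
  simpa using this

theorem exists_lipschitz_isOptimalScale (hw : ∀ j, 0 ≤ w j) (hA : 0 < supportEnergy x₀ w) :
    ∃ τ : EuclideanSpace ℝ (Fin d) → ℝ, (∀ g, IsOptimalScale x₀ w (τ g) g) ∧
      LipschitzWith (Real.sqrt (supportEnergy x₀ w))⁻¹.toNNReal τ := by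
  choose τ hτ using exists_isOptimalScale (x₀ := x₀) hw hA
  refine ⟨τ, hτ, LipschitzWith.of_dist_le_mul fun g g' => ?_⟩
  have hs := Real.sqrt_pos.2 hA
  rw [Real.coe_toNNReal _ (by positivity), Real.dist_eq, dist_eq_norm]
  have := abs_sub_scale_le hw (hτ g) (hτ g')
  rw [inv_mul_eq_div, le_div_iff₀ hs]
  linarith

theorem exists_continuous_isOptimalScale (hw : ∀ j, 0 ≤ w j) {c : ℝ}
    (hc : ∑ j, w j ^ 2 ≤ c * supportEnergy x₀ w) :
    ∃ τ : EuclideanSpace ℝ (Fin d) → ℝ, Continuous τ ∧ ∀ g, IsOptimalScale x₀ w (τ g) g := by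
  rcases (supportEnergy_nonneg (x₀ := x₀) (w := w)).eq_or_lt with hA | hA
  · have hz := eq_zero_of_supportEnergy_eq_zero hc hA.symm
    exact ⟨0, continuous_const, fun g => ⟨le_rfl, by simp [scaledSlope, hz], by simp⟩⟩
  · obtain ⟨τ, hτ, hL⟩ := exists_lipschitz_isOptimalScale hw hA
    exact ⟨τ, hL.continuous, hτ⟩

theorem statDim_descentCone_le (hw : ∀ j, 0 ≤ w j) {c : ℝ}
    (hc : ∑ j, w j ^ 2 ≤ c * supportEnergy x₀ w) {t : ℝ} (ht : 0 ≤ t) :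
    statDim (descentCone (weightedL1 w) x₀)
      ≤ ∫ g, scaledSqDist x₀ w t g ∂(stdGaussian (EuclideanSpace ℝ (Fin d))) := by
  obtain ⟨τ, hτ, hopt⟩ := exists_continuous_isOptimalScale hw hc
  rw [statDim_descentCone_eq hw hopt]
  exact integral_mono (integrable_scaledSqDist_optimal hτ hopt) (integrable_scaledSqDist t)
    fun g => (hopt g).scaledSqDist_le ht

theorem integral_sq_scaledSlope_le {t : ℝ} (hV : supportEnergy x₀ w ≤ ∑ j, w j ^ 2)
    (ht : ∫ g, scaledSlope x₀ w t g ∂(stdGaussian (EuclideanSpace ℝ (Fin d))) = 0) :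
    ∫ g, scaledSlope x₀ w t g ^ 2 ∂(stdGaussian (EuclideanSpace ℝ (Fin d)))
      ≤ 3 / 5 * supportEnergy x₀ w + 2 / 5 * ∑ j, w j ^ 2 := by
  rw [← variance_of_integral_eq_zero (continuous_scaledSlope t).aemeasurable ht]
  refine (variance_scaledSlope_le t).trans ?_
  -- Equivalent to π ≤ 10/3; this is the source of the weights 3/5 and 2/5.
  have h1 : 1 - 2 / Real.pi ≤ 2 / 5 := by
    have : 3 / 5 ≤ 2 / Real.pi := by
      rw [le_div_iff₀ Real.pi_pos]; linarith [Real.pi_lt_d2]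
    linarith
  nlinarith [mul_le_mul_of_nonneg_right h1 (sub_nonneg.2 hV)]

/-- The cross term `2 s (τ - t) - A (τ - t)²` is small on average, when the slope `s` at `t` has
mean zero. -/
theorem integral_cross_term_le {A V : ℝ} (hA : 0 < A) (hV : A ≤ V) {Ω : Type*} [MeasurableSpace Ω]
    {μ : Measure Ω} [IsProbabilityMeasure μ] {s τ : Ω → ℝ} (hs : MemLp s 2 μ) (hτ : MemLp τ 2 μ)
    (hs0 : ∫ x, s x ∂μ = 0) (hsV : ∫ x, s x ^ 2 ∂μ ≤ 3 / 5 * A + 2 / 5 * V)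
    (hτV : Var[τ; μ] ≤ 5 / 4 / A) (t : ℝ) :
    ∫ x, (2 * s x * (τ x - t) - A * (τ x - t) ^ 2) ∂μ ≤ 2 * Real.sqrt (V / A) := by
  set R := Real.sqrt (V / A) with hR
  have hR2 : R ^ 2 = V / A := Real.sq_sqrt (div_nonneg (hA.le.trans hV) hA.le)
  have hVR : V = R ^ 2 * A := by rw [hR2]; field_simp
  have hR1 : 1 ≤ R := Real.one_le_sqrt.2 ((one_le_div hA).2 hV)
  have hτt : MemLp (fun x => τ x - t) 2 μ := hτ.sub (memLp_const t)
  have hi1 : Integrable (fun x => s x * (τ x - t)) μ := hs.integrable_mul hτt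
  have hi : Integrable (fun x => 2 * s x * (τ x - t) - A * (τ x - t) ^ 2) μ := by
    refine Integrable.sub ?_ (hτt.integrable_sq.const_mul A)
    simpa [mul_assoc] using hi1.const_mul 2
  -- For R ≤ 2, the quadratic term alone absorbs the cross term, leaving E s²/A ≤ 3/5 + 2R²/5, which
  -- is at most 2R for 1 ≤ R ≤ 2. For larger R this fails eventually, and the variance of τ is used
  -- instead.
  rcases le_total R 2 with h | h
  · calc _ ≤ ∫ x, A⁻¹ * s x ^ 2 ∂μ := by
          refine integral_mono hi (hs.integrable_sq.const_mul _) fun x => ?_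
          have : A⁻¹ * s x ^ 2 - (2 * s x * (τ x - t) - A * (τ x - t) ^ 2)
              = A * (A⁻¹ * s x - (τ x - t)) ^ 2 := by field_simp; ring
          have := mul_nonneg hA.le (sq_nonneg (A⁻¹ * s x - (τ x - t)))
          simp only
          linarith
      _ ≤ A⁻¹ * (3 / 5 * A + 2 / 5 * V) := by
          rw [integral_const_mul]; gcongr
      _ = 3 / 5 + 2 / 5 * R ^ 2 := by rw [hVR]; field_simp
      _ ≤ 2 * R := by nlinarith
  · set m := ∫ x, τ x ∂μ with hm
    -- Weight for 2s(τ - m) ≤ s²/l + l(τ - m)², chosen so that both terms are of order R.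
    set l := A * R with hl
    have hl0 : 0 < l := by positivity
    have hτm : MemLp (fun x => τ x - m) 2 μ := hτ.sub (memLp_const m)
    have hs1 : Integrable s μ := hs.integrable (by norm_num)
    have hvar : ∫ x, (τ x - m) ^ 2 ∂μ ≤ 5 / 4 / A := by
      rwa [hm, ← variance_eq_integral hτ.1.aemeasurable]
    have hia : Integrable (fun x => l⁻¹ * s x ^ 2) μ := hs.integrable_sq.const_mul _
    have hib : Integrable (fun x => l * (τ x - m) ^ 2) μ := hτm.integrable_sq.const_mul _
    have hic : Integrable (fun x => 2 * (m - t) * s x) μ := hs1.const_mul _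
    have hiab : Integrable (fun x => l⁻¹ * s x ^ 2 + l * (τ x - m) ^ 2) μ := hia.add hib
    calc _ ≤ ∫ x, (l⁻¹ * s x ^ 2 + l * (τ x - m) ^ 2 + 2 * (m - t) * s x) ∂μ := by
          refine integral_mono hi (hiab.add hic) fun x => ?_
          have h1 : l⁻¹ * s x ^ 2 + l * (τ x - m) ^ 2 - 2 * s x * (τ x - m)
              = l * (l⁻¹ * s x - (τ x - m)) ^ 2 := by field_simp; ring
          have h2 := mul_nonneg hl0.le (sq_nonneg (l⁻¹ * s x - (τ x - m)))
          have h3 := mul_nonneg hA.le (sq_nonneg (τ x - t))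
          simp only
          nlinarith
      _ = l⁻¹ * (∫ x, s x ^ 2 ∂μ) + l * ∫ x, (τ x - m) ^ 2 ∂μ := by
          rw [integral_add hiab hic, integral_add hia hib, integral_const_mul, integral_const_mul,
            integral_const_mul, hs0, mul_zero, add_zero]
      _ ≤ l⁻¹ * (3 / 5 * A + 2 / 5 * V) + l * (5 / 4 / A) := by gcongr
      _ = 3 / 5 * R⁻¹ + 2 / 5 * R + 5 / 4 * R := by
          rw [hVR, hl]; field_simp
      _ ≤ 2 * R := by
          have : R⁻¹ ≤ 1 / 2 := by
            rw [inv_eq_one_div]; exact one_div_le_one_div_of_le (by norm_num) h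
          linarith

theorem supportEnergy_le : supportEnergy x₀ w ≤ ∑ j, w j ^ 2 :=
  Finset.sum_le_sum fun j _ => by split_ifs <;> [positivity; exact le_rfl]

/-- The reverse of E min ≤ min E, up to the cross term: strong convexity at t is evaluated at the
random minimiser τ(g). -/
theorem exists_integral_scaledSqDist_le (hw : ∀ j, 0 ≤ w j) {c : ℝ}
    (hc : ∑ j, w j ^ 2 ≤ c * supportEnergy x₀ w) :
    ∃ t, 0 ≤ t ∧ ∫ g, scaledSqDist x₀ w t g ∂(stdGaussian (EuclideanSpace ℝ (Fin d)))
      ≤ statDim (descentCone (weightedL1 w) x₀) + 2 * Real.sqrt c := by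
  rcases (supportEnergy_nonneg (x₀ := x₀) (w := w)).eq_or_lt with hA | hA
  · have hz := eq_zero_of_supportEnergy_eq_zero hc hA.symm
    refine ⟨0, le_rfl, ?_⟩
    rw [statDim_descentCone_eq hw (τ := fun _ => 0)
      fun g => ⟨le_rfl, by simp [scaledSlope, hz], by simp⟩]
    linarith [Real.sqrt_nonneg c]
  · obtain ⟨τ, hopt, hL⟩ := exists_lipschitz_isOptimalScale hw hA
    obtain ⟨t, ht, hts⟩ := exists_integral_scaledSlope_eq_zero hw hA
    refine ⟨t, ht, ?_⟩
    set μ := stdGaussian (EuclideanSpace ℝ (Fin d))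
    set A := supportEnergy x₀ w with hAdef
    have hτ2 := lipschitz_memLp_two hL
    have hτV : Var[τ; μ] ≤ 5 / 4 / A := by
      refine (variance_le_of_lipschitz hL).trans ?_
      rw [Real.coe_toNNReal _ (by positivity), inv_pow, Real.sq_sqrt hA.le, ← div_eq_mul_inv]
      refine div_le_div_of_nonneg_right ?_ hA.le
      -- Since π² < 10, the Poincaré constant π²/8 is below 5/4.
      nlinarith [Real.pi_lt_d2, Real.pi_pos]
    have hs := memLp_scaledSlope (x₀ := x₀) (w := w) t
    have hcross := integral_cross_term_le hA supportEnergy_le hs hτ2 hts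
      (integral_sq_scaledSlope_le supportEnergy_le hts) hτV t
    have hτt : MemLp (fun g => τ g - t) 2 μ := hτ2.sub (memLp_const t)
    have hi : Integrable (fun g => 2 * scaledSlope x₀ w t g * (τ g - t) - A * (τ g - t) ^ 2) μ := by
      refine Integrable.sub ?_ (hτt.integrable_sq.const_mul A)
      have h := (hs.integrable_mul hτt).const_mul 2
      simpa [mul_assoc] using h
    have hopti := integrable_scaledSqDist_optimal hL.continuous hopt
    have hle : ∫ g, scaledSqDist x₀ w t g ∂μ ≤ ∫ g, (scaledSqDist x₀ w (τ g) g
        + (2 * scaledSlope x₀ w t g * (τ g - t) - A * (τ g - t) ^ 2)) ∂μ :=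
      integral_mono (integrable_scaledSqDist t) (hopti.add hi) fun g => by
        have := scaledSqDist_ge (x₀ := x₀) (w := w) t (τ g) g
        simp only
        linarith
    rw [integral_add hopti hi, ← statDim_descentCone_eq hw hopt] at hle
    have hsq : Real.sqrt ((∑ j, w j ^ 2) / A) ≤ Real.sqrt c :=
      Real.sqrt_le_sqrt ((div_le_iff₀ hA).2 hc)
    linarith

/-- The mean squared distance at scale `0` is approximated by the one at positive scales. -/
theorem integral_scaledSqDist_le_zero (hw : ∀ j, 0 ≤ w j) {t : ℝ} (ht : 0 ≤ t) :
    ∫ g, scaledSqDist x₀ w t g ∂(stdGaussian (EuclideanSpace ℝ (Fin d)))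
      ≤ ∫ g, scaledSqDist x₀ w 0 g ∂(stdGaussian (EuclideanSpace ℝ (Fin d)))
        + 2 * t ^ 2 * ∑ j, w j ^ 2 := by
  set μ := stdGaussian (EuclideanSpace ℝ (Fin d))
  have hs : Integrable (fun g => 2 * t * scaledSlope x₀ w t g) μ :=
    ((memLp_scaledSlope t).integrable (by norm_num)).const_mul _
  have h1 : ∫ g, (scaledSqDist x₀ w t g + 2 * t * scaledSlope x₀ w t g) ∂μ
      ≤ ∫ g, scaledSqDist x₀ w 0 g ∂μ :=
    integral_mono ((integrable_scaledSqDist t).add hs) (integrable_scaledSqDist 0) fun g => by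
      have := scaledSqDist_ge (x₀ := x₀) (w := w) t 0 g
      have := mul_nonneg (supportEnergy_nonneg (x₀ := x₀) (w := w)) (sq_nonneg (0 - t))
      simp only
      linarith
  rw [integral_add (integrable_scaledSqDist t) hs, integral_const_mul] at h1
  nlinarith [mul_le_mul_of_nonneg_left (neg_le_integral_scaledSlope (x₀ := x₀) hw ht) ht]

end StatisticalDimension

/-! ### Translation to the parameters of the partition. -/

section Blocks

variable {d k : ℕ} {S : Fin k → Finset (Fin d)} {x₀ : EuclideanSpace ℝ (Fin d)} {ω : Fin k → ℝ}

theorem blockWeight_eq (hdisj : ∀ i i' : Fin k, i ≠ i' → Disjoint (S i) (S i')) {i : Fin k}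
    {j : Fin d} (hj : j ∈ S i) : blockWeight S ω j = ω i := by
  rw [blockWeight, Finset.sum_eq_single i, if_pos hj]
  · exact fun i' _ hi' => if_neg fun h => Finset.disjoint_left.1 (hdisj i' i hi') h hj
  · simp

theorem blockWeight_nonneg (hω : ∀ i, 0 ≤ ω i) (j : Fin d) : 0 ≤ blockWeight S ω j :=
  Finset.sum_nonneg fun i _ => by split_ifs <;> [exact hω i; exact le_rfl]

theorem sum_eq_sum_blocks (hdisj : ∀ i i' : Fin k, i ≠ i' → Disjoint (S i) (S i'))
    (hcover : ∀ j : Fin d, ∃ i : Fin k, j ∈ S i) {f : Fin d → ℝ} {a b : Fin k → ℝ}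
    (hf : ∀ i, ∀ j ∈ S i, f j = if x₀ j = 0 then b i else a i) :
    ∑ j, f j = ∑ i, (((vecSupport x₀ ∩ S i).card : ℝ) * a i
      + ((S i).card - (vecSupport x₀ ∩ S i).card) * b i) := by
  have hu : (Finset.univ : Finset (Fin d)) = Finset.univ.biUnion S := by
    ext j; simpa using hcover j
  rw [hu, Finset.sum_biUnion fun i _ i' _ h => hdisj i i' h]
  refine Finset.sum_congr rfl fun i _ => ?_
  have hT : vecSupport x₀ ∩ S i = (S i).filter fun j => x₀ j ≠ 0 := by
    ext j; simp [vecSupport, and_comm]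
  have hcard := Finset.card_filter_add_card_filter_not (s := S i) (fun j => x₀ j = 0)
  have hcard' : ((S i).card : ℝ) = ((S i).filter fun j => x₀ j = 0).card
      + ((S i).filter fun j => x₀ j ≠ 0).card := by exact_mod_cast hcard.symm
  rw [Finset.sum_congr rfl (hf i), Finset.sum_ite, Finset.sum_const, Finset.sum_const, hT, hcard',
    nsmul_eq_mul, nsmul_eq_mul]
  ring

/-- Positive density excludes empty blocks, for which division by zero would give density 0. -/
theorem relDensity_mul_card (hα : ∀ i : Fin k, 0 < relDensity S (vecSupport x₀) i) (i : Fin k) :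
    relDensity S (vecSupport x₀) i * (S i).card = (vecSupport x₀ ∩ S i).card := by
  refine div_mul_cancel₀ _ fun h => (hα i).ne' ?_
  rw [relDensity, h, div_zero]

/-- A support coordinate in block i contributes 1 + (ω_i t)² and any other φ(ω_i t); the ones add up
to |T| = σ d. -/
theorem Jfun_eq_integral_div (hd : 0 < d) (hdisj : ∀ i i' : Fin k, i ≠ i' → Disjoint (S i) (S i'))
    (hcover : ∀ j : Fin d, ∃ i : Fin k, j ∈ S i)
    (hα : ∀ i : Fin k, 0 < relDensity S (vecSupport x₀) i) (hω : ∀ i, 0 ≤ ω i) {t : ℝ}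
    (ht : 0 ≤ t) :
    Jfun (((vecSupport x₀).card : ℝ) / d) (relDensity S (vecSupport x₀)) (relSize S) ω t
      = (∫ g, scaledSqDist x₀ (blockWeight S ω) t g ∂(stdGaussian (EuclideanSpace ℝ (Fin d)))) / d
    := by
  have hd' : (0 : ℝ) < d := by exact_mod_cast hd
  have hT : ((vecSupport x₀).card : ℝ) = ∑ i, ((vecSupport x₀ ∩ S i).card : ℝ) := by
    have h := sum_eq_sum_blocks (x₀ := x₀) (f := fun j => if x₀ j = 0 then 0 else 1)
      (a := fun _ => 1) (b := fun _ => 0) hdisj hcover fun i j _ => rfl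
    simp only [mul_one, mul_zero, add_zero] at h
    rw [← h, Finset.sum_ite]
    simp [vecSupport]
  rw [integral_scaledSqDist (blockWeight_nonneg hω) ht,
    sum_eq_sum_blocks (x₀ := x₀) (a := fun i => 1 + (t * ω i) ^ 2)
      (b := fun i => gaussTail (t * ω i)) hdisj hcover
      fun i j hj => by rw [blockWeight_eq hdisj hj],
    Jfun, hT, Finset.sum_div, Finset.sum_div, ← Finset.sum_add_distrib]
  refine Finset.sum_congr rfl fun i _ => ?_
  rw [relSize, ← relDensity_mul_card hα i, mul_comm t (ω i)]
  field_simp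
  ring

theorem minDensity_spec [Nonempty (Fin k)] :
    ∃ i, relDensity S (vecSupport x₀) i = minDensity S (vecSupport x₀) :=
  exists_eq_ciInf_of_finite

/-- Weights are constant on a block, and a fraction α_i ≥ ᾱ of each block lies in the support, so A
≥ ᾱ V. -/
theorem sum_sq_blockWeight_le [Nonempty (Fin k)]
    (hdisj : ∀ i i' : Fin k, i ≠ i' → Disjoint (S i) (S i'))
    (hcover : ∀ j : Fin d, ∃ i : Fin k, j ∈ S i)
    (hα : ∀ i : Fin k, 0 < relDensity S (vecSupport x₀) i) :
    ∑ j, blockWeight S ω j ^ 2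
      ≤ 1 / minDensity S (vecSupport x₀) * supportEnergy x₀ (blockWeight S ω) := by
  obtain ⟨i₀, hi₀⟩ := minDensity_spec (S := S) (x₀ := x₀)
  have hmin : 0 < minDensity S (vecSupport x₀) := hi₀ ▸ hα i₀
  rw [one_div, inv_mul_eq_div, le_div_iff₀ hmin, supportEnergy,
    sum_eq_sum_blocks (x₀ := x₀) (a := fun i => ω i ^ 2) (b := fun i => ω i ^ 2) hdisj hcover
      fun i j hj => by rw [blockWeight_eq hdisj hj, ite_self],
    sum_eq_sum_blocks (x₀ := x₀) (a := fun i => ω i ^ 2) (b := fun _ => 0) hdisj hcover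
      fun i j hj => by rw [blockWeight_eq hdisj hj], Finset.sum_mul]
  refine Finset.sum_le_sum fun i _ => ?_
  have h1 : minDensity S (vecSupport x₀) ≤ relDensity S (vecSupport x₀) i :=
    ciInf_le (Set.finite_range _).bddBelow i
  have h2 := relDensity_mul_card hα i
  have h3 := mul_le_mul_of_nonneg_right h1 (Nat.cast_nonneg (α := ℝ) (S i).card)
  rw [h2] at h3
  nlinarith [mul_le_mul_of_nonneg_right h3 (sq_nonneg (ω i))]

/-- At the minimising block, 1/ᾱ = |S_i| / |T ∩ S_i|, with numerator at most d and denominator at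
least 1. -/
theorem one_div_minDensity_le [Nonempty (Fin k)]
    (hα : ∀ i : Fin k, 0 < relDensity S (vecSupport x₀) i) :
    1 / minDensity S (vecSupport x₀) ≤ d := by
  obtain ⟨i, hi⟩ := minDensity_spec (S := S) (x₀ := x₀)
  have h := hα i
  rw [← hi, one_div, relDensity, inv_div]
  have hT : 0 < (vecSupport x₀ ∩ S i).card := by
    rw [Nat.pos_iff_ne_zero]
    intro h0
    simp [relDensity, h0] at h
  have hT' : (1 : ℝ) ≤ (vecSupport x₀ ∩ S i).card := by exact_mod_cast hT
  have hS : ((S i).card : ℝ) ≤ d := by exact_mod_cast (S i).card_le_univ.trans_eq (by simp)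
  exact (div_le_self (Nat.cast_nonneg _) hT').trans hS

theorem bddBelow_Jfun (hd : 0 < d) (hdisj : ∀ i i' : Fin k, i ≠ i' → Disjoint (S i) (S i'))
    (hcover : ∀ j : Fin d, ∃ i : Fin k, j ∈ S i)
    (hα : ∀ i : Fin k, 0 < relDensity S (vecSupport x₀) i) (hω : ∀ i, 0 ≤ ω i) :
    BddBelow (Set.range fun τ : Set.Ioi (0 : ℝ) => Jfun (((vecSupport x₀).card : ℝ) / d)
      (relDensity S (vecSupport x₀)) (relSize S) ω τ) := by
  refine ⟨0, ?_⟩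
  rintro _ ⟨τ, rfl⟩
  simp only
  rw [Jfun_eq_integral_div hd hdisj hcover hα hω (le_of_lt τ.2)]
  exact div_nonneg (integral_nonneg fun g => scaledSqDist_nonneg _ _) (Nat.cast_nonneg _)

/-- The scale t = 0 is excluded from the infimum but can occur in the lower bound, so it is reached
as a limit of positive scales. -/
theorem mTilde_le_integral (hd : 0 < d) (hdisj : ∀ i i' : Fin k, i ≠ i' → Disjoint (S i) (S i'))
    (hcover : ∀ j : Fin d, ∃ i : Fin k, j ∈ S i)
    (hα : ∀ i : Fin k, 0 < relDensity S (vecSupport x₀) i) (hω : ∀ i, 0 ≤ ω i) {t : ℝ}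
    (ht : 0 ≤ t) :
    mTilde S (vecSupport x₀) ω ≤
      (∫ g, scaledSqDist x₀ (blockWeight S ω) t g ∂(stdGaussian (EuclideanSpace ℝ (Fin d)))) / d
    := by
  have hpos : ∀ τ : ℝ, 0 < τ → mTilde S (vecSupport x₀) ω ≤
      (∫ g, scaledSqDist x₀ (blockWeight S ω) τ g
        ∂(stdGaussian (EuclideanSpace ℝ (Fin d)))) / d := fun τ hτ => by
    rw [← Jfun_eq_integral_div hd hdisj hcover hα hω hτ.le]
    exact ciInf_le (bddBelow_Jfun hd hdisj hcover hα hω) (⟨τ, hτ⟩ : Set.Ioi (0 : ℝ))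
  rcases ht.eq_or_lt with rfl | ht
  · set I := ∫ g, scaledSqDist x₀ (blockWeight S ω) 0 g ∂(stdGaussian (EuclideanSpace ℝ (Fin d)))
    set V := ∑ j, blockWeight S ω j ^ 2
    have hlim : Filter.Tendsto (fun τ : ℝ => (I + 2 * τ ^ 2 * V) / d)
        (nhdsWithin 0 (Set.Ioi 0)) (nhds (I / d)) := by
      have hc : Continuous fun τ : ℝ => (I + 2 * τ ^ 2 * V) / d := by fun_prop
      have := hc.tendsto 0
      simp only [ne_eq, OfNat.ofNat_ne_zero, not_false_eq_true, zero_pow, mul_zero, zero_mul,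
        add_zero] at this
      exact this.mono_left nhdsWithin_le_nhds
    refine ge_of_tendsto hlim (eventually_nhdsWithin_of_forall fun τ hτ => ?_)
    refine (hpos τ hτ).trans ?_
    gcongr
    exact integral_scaledSqDist_le_zero (blockWeight_nonneg hω) (le_of_lt hτ)
  · exact hpos t ht

end Blocks

theorem proposition2p6 (d k : ℕ) (hd : 0 < d)
    (S : Fin k → Finset (Fin d))
    (hdisj : ∀ i i' : Fin k, i ≠ i' → Disjoint (S i) (S i'))
    (hcover : ∀ j : Fin d, ∃ i : Fin k, j ∈ S i)
    (x₀ : EuclideanSpace ℝ (Fin d))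
    (hα : ∀ i : Fin k, 0 < relDensity S (vecSupport x₀) i)
    (ω : Fin k → ℝ) (hω : ∀ i, 0 ≤ ω i) :
    (mTilde S (vecSupport x₀) ω
          - 2 / (d : ℝ) * Real.sqrt (1 / minDensity S (vecSupport x₀))
        ≤ statDim (descentCone (weightedL1 (blockWeight S ω)) x₀) / (d : ℝ) ∧
      statDim (descentCone (weightedL1 (blockWeight S ω)) x₀) / (d : ℝ)
        ≤ mTilde S (vecSupport x₀) ω) ∧
    (mTilde S (vecSupport x₀) ω - 2 / Real.sqrt (d : ℝ)
        ≤ statDim (descentCone (weightedL1 (blockWeight S ω)) x₀) / (d : ℝ) ∧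
      statDim (descentCone (weightedL1 (blockWeight S ω)) x₀) / (d : ℝ)
        ≤ mTilde S (vecSupport x₀) ω) := by
  have hd' : (0 : ℝ) < d := by exact_mod_cast hd
  -- A block exists because d > 0, so ᾱ is an attained minimum and not the default value of an empty
  -- infimum.
  obtain ⟨i₀, -⟩ := hcover ⟨0, hd⟩
  have : Nonempty (Fin k) := ⟨i₀⟩
  have hw := blockWeight_nonneg (S := S) hω
  have hc := sum_sq_blockWeight_le (ω := ω) hdisj hcover hα
  have hupper : statDim (descentCone (weightedL1 (blockWeight S ω)) x₀) / (d : ℝ)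
      ≤ mTilde S (vecSupport x₀) ω := by
    have : Nonempty (Set.Ioi (0 : ℝ)) := ⟨⟨1, Set.mem_Ioi.2 one_pos⟩⟩
    refine le_ciInf fun τ => ?_
    rw [Jfun_eq_integral_div hd hdisj hcover hα hω (le_of_lt τ.2)]
    gcongr
    exact statDim_descentCone_le hw hc (le_of_lt τ.2)
  have hlower : mTilde S (vecSupport x₀) ω
      - 2 / (d : ℝ) * Real.sqrt (1 / minDensity S (vecSupport x₀))
      ≤ statDim (descentCone (weightedL1 (blockWeight S ω)) x₀) / (d : ℝ) := by
    obtain ⟨t, ht, hle⟩ := exists_integral_scaledSqDist_le hw hc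
    have h1 := mTilde_le_integral hd hdisj hcover hα hω ht
    have h2 := div_le_div_of_nonneg_right hle hd'.le
    rw [add_div] at h2
    have h3 : 2 / (d : ℝ) * Real.sqrt (1 / minDensity S (vecSupport x₀))
        = 2 * Real.sqrt (1 / minDensity S (vecSupport x₀)) / d := by ring
    linarith
  refine ⟨⟨hlower, hupper⟩, ?_, hupper⟩
  refine le_trans ?_ hlower
  have h4 := Real.sqrt_le_sqrt (one_div_minDensity_le hα)
  have h5 : 2 / Real.sqrt (d : ℝ) = 2 / (d : ℝ) * Real.sqrt d := by
    have hs := Real.sqrt_pos.2 hd'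
    have := Real.sq_sqrt hd'.le
    field_simp
    linarith
  rw [h5]
  gcongr
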